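/- **Theorem 2.** The direct mapping $\mathcal{DM}$ is query preserving: for every relational schema $\mathbf R$ (a nonempty finite set of relation names, each with a nonempty finite set of attributes), every finite set $\Sigma$ of primary keys and foreign keys over $\mathbf R$, and every relational algebra query $Q$ over $\mathbf R$, there is a SPARQL 1.1 query $Q^\star$ such that for every (finite) instance $I$ of $\mathbf R$, possibly with null values, that satisfies $\Sigma$, $$\mathrm{tr}(\llbracket Q\rrbracket_I)=\llbracket Q^\star\rrbracket_{\mathcal{DM}(\mathbf R,\Sigma,I)} .$$ *Relational side.* Tuples over a finite attribute set $U$ are functions $t:U\to \mathbf D\cup\{\mathrm{NULL}\}$. Queries are built from relation names, $\mathrm{NULL}_A$ (whose only tuple is $A\mapsto\mathrm{NULL}$), $\sigma_{A=a}$, $\sigma_{A\ne a}$ (which also requires $t.A\neq\mathrm{NULL}$), $\sigma_{\mathrm{IsNull}(A)}$, $\sigma_{\mathrm{IsNotNull}(A)}$, $\pi_U$ with $U\subseteq\mathrm{att}$, renaming $\delta_{A\to B}$ to a new attribute $B$, natural join (equal and non-null on the common attributes), and union and difference of queries with the same attributes. A key $R[A_1,\dots,A_m]$ ($m\ge1$,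 the $A_i$ distinct) requires non-null values and uniqueness; $\Sigma$ has at most one key per relation name. A foreign key $R[A_1,\dots,A_m]\subseteq S[B_1,\dots,B_m]$ requires that $S[B_1,\dots,B_m]$ is satisfied as a key and that each tuple of $R$ is null in some $A_k$ or agrees in all $A_k$ with the $B_k$ of some tuple of $S$. For a tuple $t$, the mapping $\mathrm{tr}(t)$ is defined on the variables $?A$ with $t.A\ne\mathrm{NULL}$, with value $t.A$; the elements of $\mathbf D$ are RDF literals. *SPARQL side.* Queries are graph patterns built from the empty pattern $\{\,\}$ (with value $\{\mu_\emptyset\}$ over a nonempty graph, and $\emptyset$ over the empty one), triple patterns, AND, OPT, UNION, MINUS, FILTER with Boolean combinations of $\mathrm{bound}(?X)$, $?X=c$ ($c$ an IRI or literal) and $?X=?Y$, and nested SELECT $\{?A_1\text{ AS }?B_1,\dots,?A_m\text{ AS }?B_m,?C_1,\dots,?C_n\}\,P$, with pairwise distinct variables and no $?B_i$ occurring in $P$. They have the standard set semantics. They are non-parametric: a variable that occurs in the argument of a SELECT and is none of its $?A_i,?C_j$ does not occur outside that SELECT. *The mapping $\mathcal{DM}$.* A relation $R$ is *binary* if its attributes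 are exactly two attributes $A,B$, its key in $\Sigma$ is $R[A,B]$, there are single-attribute foreign keys $R[A]\subseteq S[C]$ and $R[B]\subseteq T[D]$ in $\Sigma$ with $S,T\ne R$, neither $A$ nor $B$ has a second single-attribute foreign key in $R$, no foreign key of $R$ has the source list $A,B$ or $B,A$, and no one- or two-attribute foreign key references $R$. With a base IRI $\mathtt{base}$, IRIs are concatenations of strings: * class IRI of $R$: $\mathtt{base}\,R$ * data type property of the attribute $A$ of $R$: $\mathtt{base}\,R\#A$ * property of a binary relation $R$: $\mathtt{base}\,R\#A,B,C,D$ * property of a foreign key from $S[X_1..X_n]$ to $T[Y_1..Y_n]$: $\mathtt{base}\,S,T\#X_1,\dots,X_n,Y_1,\dots,Y_n$ * node of a tuple of $R$: the IRI $\mathtt{base}\,R\#A_1{=}v_1,\dots,A_n{=}v_n$ if $R$ has the key $R[A_1,\dots,A_n]$ in $\Sigma$ (with $v_i$ the value in $A_i$), otherwise the blank node labelled $\_{:}R\,\mathit{id}$, with $\mathit{id}$ the identifier of the tuple. The graph consists of the following triples. * Each non-binary $R$ (a class) has type owl:Class. Each of its attributes' properties has type owl:DatatypeProperty and has the class of $R$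 as rdfs:domain. * The property of each foreign key of a non-binary $S$ to $T$ has type owl:ObjectProperty, has the class of $S$ as rdfs:domain, and has the class of $T$ as rdfs:range if $T$ is non-binary. * The node of each tuple of a non-binary $R$ has the class of $R$ as its rdf:type and, for each attribute $A$ with a non-null value, that value as its value of the property of $A$. * For each such foreign key, its property links the node of a tuple $t$ of $S$ to the node of a tuple $t'$ of $T$ ($T$ non-binary) if the values of $t$ in $X_1,\dots,X_n$ are those of $t'$ in $Y_1,\dots,Y_n$. * For each tuple $t$ of a binary relation $R$ as above, the property of $R$ links the node of a tuple $s$ of $S$ to the node of a tuple $s'$ of $T$ whenever $s.C=t.A$ and $s'.D=t.B$. *Conventions on generated identifiers.* Relation names, attribute names and the lexical forms used for the elements of $\mathbf D$ are strings without the delimiters `#`, `,` and `=`; different elements of $\mathbf D$ have different lexical forms; $\mathtt{base}$ is not a prefix of one of the six RDF, RDFS and OWL vocabulary IRIs used above; and different tuples of an instance have different blank node labels. -/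

import Mathlib

namespace DirectMap

universe u

/-! Strings, and the names that are used inside generated IRIs. -/

/-- Character strings. -/
abbrev Str := List Char

/-- The string with the given character codes. -/
def ofCodes (l : List ℕ) : Str := l.map Char.ofNat

/-- The hash sign. -/
def hash : Char := Char.ofNat 35
/-- The comma. -/
def comma : Char := Char.ofNat 44
/-- The equality sign. -/
def equals : Char := Char.ofNat 61

/-- The delimiters (hash sign, comma, equality sign) that the direct mapping writes between the
components of a generated IRI. -/
def IsDelimiter (c : Char) : Prop := c = hash ∨ c = comma ∨ c = equals

/-- Names (of relations and attributes) and lexical forms of constants: strings in which no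
delimiter of generated IRIs occurs. -/
abbrev Name := {s : Str // ∀ c ∈ s, ¬ IsDelimiter c}

/-- The string `NULL`. -/
def nullName : Name :=
  ⟨ofCodes [78, 85, 76, 76], by
    simp [ofCodes, IsDelimiter, hash, comma, equals]⟩

/-! Relational databases. The reserved symbol `NULL` is `none : Option D`. -/

/-- A relational schema: a nonempty finite set of relation names, each with a nonempty finite set
of attribute names. -/
structure Schema where
  rels : Finset Name
  rels_nonempty : rels.Nonempty
  att : {r // r ∈ rels} → Finset Name
  att_nonempty : ∀ r, (att r).Nonempty

/-- The relation names of a schema. -/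
abbrev Schema.Rel (S : Schema) := {r // r ∈ S.rels}

/-- Tuples with the set `U` of attributes, with values in `D ∪ {NULL}`. -/
abbrev Tuple (D : Type u) (U : Finset Name) := {A // A ∈ U} → Option D

/-- The value `t.A`. It is only used for attributes `A ∈ U`. -/
def Tuple.val {D : Type u} {U : Finset Name} (t : Tuple D U) (A : Name) : Option D :=
  if h : A ∈ U then t ⟨A, h⟩ else none

/-- Instances of a schema: a finite set of tuples for each relation name. -/
structure Instance (D : Type u) (S : Schema) where
  rel : (r : S.Rel) → Set (Tuple D (S.att r))
  finite : ∀ r, (rel r).Finite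

/-- Relational algebra expressions over `S`, indexed by their set of attributes. -/
inductive RA (D : Type u) (S : Schema) : Finset Name → Type u
  | rel (r : S.Rel) : RA D S (S.att r)
  | null (A : Name) : RA D S {A}
  | selEq {U : Finset Name} (A : Name) (a : D) (hA : A ∈ U) (Q : RA D S U) : RA D S U
  | selNe {U : Finset Name} (A : Name) (a : D) (hA : A ∈ U) (Q : RA D S U) : RA D S U
  | selNull {U : Finset Name} (A : Name) (hA : A ∈ U) (Q : RA D S U) : RA D S U
  | selNotNull {U : Finset Name} (A : Name) (hA : A ∈ U) (Q : RA D S U) : RA D S U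
  | proj {U : Finset Name} (V : Finset Name) (hV : V ⊆ U) (Q : RA D S U) : RA D S V
  | rename {U : Finset Name} (A B : Name) (hA : A ∈ U) (hB : B ∉ U) (Q : RA D S U) :
      RA D S (insert B (U.erase A))
  | join {U V : Finset Name} (Q₁ : RA D S U) (Q₂ : RA D S V) : RA D S (U ∪ V)
  | union {U : Finset Name} (Q₁ Q₂ : RA D S U) : RA D S U
  | diff {U : Finset Name} (Q₁ Q₂ : RA D S U) : RA D S U

/-- The evaluation of a relational algebra expression over an instance. -/
def RA.eval {D : Type u} {S : Schema} (I : Instance D S) :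
    {U : Finset Name} → RA D S U → Set (Tuple D U)
  | _, .rel r => I.rel r
  | _, .null A => {t | t.val A = none}
  | _, .selEq A a _ Q => {t | t ∈ Q.eval I ∧ t.val A = some a}
  | _, .selNe A a _ Q => {t | t ∈ Q.eval I ∧ t.val A ≠ none ∧ t.val A ≠ some a}
  | _, .selNull A _ Q => {t | t ∈ Q.eval I ∧ t.val A = none}
  | _, .selNotNull A _ Q => {t | t ∈ Q.eval I ∧ t.val A ≠ none}
  | _, .proj V _ Q => {t | ∃ t' ∈ Q.eval I, ∀ A ∈ V, t.val A = t'.val A}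
  | _, .rename (U := U) A B _ _ Q =>
      {t | ∃ t' ∈ Q.eval I, t.val B = t'.val A ∧
        ∀ C ∈ insert B (U.erase A), C ≠ B → t.val C = t'.val C}
  | _, .join (U := U) (V := V) Q₁ Q₂ =>
      {t | ∃ t₁ ∈ Q₁.eval I, ∃ t₂ ∈ Q₂.eval I,
        (∀ A ∈ U ∩ V, t.val A = t₁.val A ∧ t₁.val A = t₂.val A ∧ t.val A ≠ none) ∧
        (∀ A ∈ U \ V, t.val A = t₁.val A) ∧
        (∀ A ∈ V \ U, t.val A = t₂.val A)}
  | _, .union Q₁ Q₂ => Q₁.eval I ∪ Q₂.eval I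
  | _, .diff Q₁ Q₂ => Q₁.eval I \ Q₂.eval I

/-! Keys and foreign keys. -/

/-- A key `R[A₁, …, Aₘ]`, with pairwise distinct attributes. -/
structure Key (S : Schema) where
  rel : S.Rel
  attrs : List Name
  attrs_ne_nil : attrs ≠ []
  attrs_nodup : attrs.Nodup
  attrs_mem : ∀ A ∈ attrs, A ∈ S.att rel

/-- A foreign key, from `R[A₁, …, Aₘ]` to `S[B₁, …, Bₘ]`. -/
structure ForeignKey (S : Schema) where
  src : S.Rel
  srcAttrs : List Name
  dst : S.Rel
  dstAttrs : List Name
  length_eq : srcAttrs.length = dstAttrs.length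
  srcAttrs_ne_nil : srcAttrs ≠ []
  srcAttrs_mem : ∀ A ∈ srcAttrs, A ∈ S.att src
  dstAttrs_mem : ∀ B ∈ dstAttrs, B ∈ S.att dst

/-- `I` satisfies the key `r[As]`. -/
def Instance.SatKey {D : Type u} {S : Schema} (I : Instance D S) (r : S.Rel) (As : List Name) :
    Prop :=
  (∀ t ∈ I.rel r, ∀ A ∈ As, t.val A ≠ none) ∧
  (∀ t₁ ∈ I.rel r, ∀ t₂ ∈ I.rel r, (∀ A ∈ As, t₁.val A = t₂.val A) → t₁ = t₂)

/-- `I` satisfies a foreign key. -/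
def Instance.SatForeignKey {D : Type u} {S : Schema} (I : Instance D S) (f : ForeignKey S) :
    Prop :=
  I.SatKey f.dst f.dstAttrs ∧
  ∀ t ∈ I.rel f.src,
    (∃ A ∈ f.srcAttrs, t.val A = none) ∨
    ∃ s ∈ I.rel f.dst, f.srcAttrs.map t.val = f.dstAttrs.map s.val

/-- A set of primary keys and foreign keys over `S`. -/
structure Constraints (S : Schema) where
  keys : Finset (Key S)
  fks : Finset (ForeignKey S)
  keys_unique : ∀ k₁ ∈ keys, ∀ k₂ ∈ keys, k₁.rel = k₂.rel → k₁ = k₂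

/-- `I` satisfies a set of primary keys and foreign keys. -/
def Instance.Sat {D : Type u} {S : Schema} (I : Instance D S) (C : Constraints S) : Prop :=
  (∀ k ∈ C.keys, I.SatKey k.rel k.attrs) ∧ (∀ f ∈ C.fks, I.SatForeignKey f)

/-! RDF graphs. The constants of the database are the literals. -/

/-- IRIs and blank nodes. -/
inductive Node
  | iri (s : Str)
  | blank (s : Str)

/-- IRIs, blank nodes and literals. -/
inductive Term (D : Type u)
  | node (n : Node)
  | lit (d : D)

/-- An RDF triple. Its predicate is an IRI. -/
structure Triple (D : Type u) where
  subj : Node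
  pred : Str
  obj : Term D

/-- An RDF graph: a finite set of RDF triples. -/
abbrev Graph (D : Type u) := {G : Set (Triple D) // G.Finite}

/-- The IRI `rdf:type`, that is `www.w3.org/1999/02/22-rdf-syntax-ns#type`
with the usual scheme prefix, as a list of character codes. -/
def rdfType : Str :=
  ofCodes [
   104, 116, 116, 112, 58, 47, 47, 119, 119, 119, 46, 119, 51, 46, 111, 114, 103, 47, 49, 57,
   57, 57, 47, 48, 50, 47, 50, 50, 45, 114, 100, 102, 45, 115, 121, 110, 116, 97, 120, 45,
   110, 115, 35, 116, 121, 112, 101]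

/-- The IRI `owl:Class`, that is `www.w3.org/2002/07/owl#Class`
with the usual scheme prefix, as a list of character codes. -/
def owlClass : Str :=
  ofCodes [
   104, 116, 116, 112, 58, 47, 47, 119, 119, 119, 46, 119, 51, 46, 111, 114, 103, 47, 50, 48,
   48, 50, 47, 48, 55, 47, 111, 119, 108, 35, 67, 108, 97, 115, 115]

/-- The IRI `owl:ObjectProperty`, that is `www.w3.org/2002/07/owl#ObjectProperty`
with the usual scheme prefix, as a list of character codes. -/
def owlObjectProperty : Str :=
  ofCodes [
   104, 116, 116, 112, 58, 47, 47, 119, 119, 119, 46, 119, 51, 46, 111, 114, 103, 47, 50, 48,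
   48, 50, 47, 48, 55, 47, 111, 119, 108, 35, 79, 98, 106, 101, 99, 116, 80, 114, 111, 112,
   101, 114, 116, 121]

/-- The IRI `owl:DatatypeProperty`, that is `www.w3.org/2002/07/owl#DatatypeProperty`
with the usual scheme prefix, as a list of character codes. -/
def owlDatatypeProperty : Str :=
  ofCodes [
   104, 116, 116, 112, 58, 47, 47, 119, 119, 119, 46, 119, 51, 46, 111, 114, 103, 47, 50, 48,
   48, 50, 47, 48, 55, 47, 111, 119, 108, 35, 68, 97, 116, 97, 116, 121, 112, 101, 80, 114,
   111, 112, 101, 114, 116, 121]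

/-- The IRI `rdfs:domain`, that is `www.w3.org/2000/01/rdf-schema#domain`
with the usual scheme prefix, as a list of character codes. -/
def rdfsDomain : Str :=
  ofCodes [
   104, 116, 116, 112, 58, 47, 47, 119, 119, 119, 46, 119, 51, 46, 111, 114, 103, 47, 50, 48,
   48, 48, 47, 48, 49, 47, 114, 100, 102, 45, 115, 99, 104, 101, 109, 97, 35, 100, 111, 109,
   97, 105, 110]

/-- The IRI `rdfs:range`, that is `www.w3.org/2000/01/rdf-schema#range`
with the usual scheme prefix, as a list of character codes. -/
def rdfsRange : Str :=
  ofCodes [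
   104, 116, 116, 112, 58, 47, 47, 119, 119, 119, 46, 119, 51, 46, 111, 114, 103, 47, 50, 48,
   48, 48, 47, 48, 49, 47, 114, 100, 102, 45, 115, 99, 104, 101, 109, 97, 35, 114, 97, 110,
   103, 101]

/-- The RDF, RDFS and OWL terms that the direct mapping uses. -/
def vocabulary : List Str :=
  [rdfType, owlClass, owlObjectProperty, owlDatatypeProperty, rdfsDomain, rdfsRange]

/-! SPARQL. -/

/-- The variable `?A` is represented by the name `A`. -/
abbrev Var := Name

/-- Mappings: partial functions from variables to IRIs, blank nodes and literals. -/
abbrev Mapping (D : Type u) := Var → Option (Term D)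

namespace Mapping

variable {D : Type u}

/-- The domain of a mapping. -/
def dom (μ : Mapping D) : Set Var := {x | μ x ≠ none}

/-- The mapping with empty domain. -/
def empty : Mapping D := fun _ => none

/-- Compatibility of mappings. -/
def Compatible (μ₁ μ₂ : Mapping D) : Prop := ∀ x ∈ μ₁.dom ∩ μ₂.dom, μ₁ x = μ₂ x

/-- The union of two (compatible) mappings. -/
def union (μ₁ μ₂ : Mapping D) : Mapping D := fun x => (μ₁ x).or (μ₂ x)

/-- The restriction of a mapping to a list of variables. -/
def restrict (μ : Mapping D) (W : List Var) : Mapping D := fun x => if x ∈ W then μ x else none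

/-- The renaming of `?A` to `?B` for every pair `(?A, ?B)` of a list. -/
def rename (l : List (Var × Var)) (μ : Mapping D) : Mapping D := fun x =>
  match l.find? (fun p => p.2 = x) with
  | some p => μ p.1
  | none => if x ∈ l.map Prod.fst then none else μ x

end Mapping

/-- Subjects and objects of triple patterns. -/
inductive PTerm (D : Type u)
  | iri (s : Str)
  | lit (d : D)
  | var (x : Var)

/-- Predicates of triple patterns. -/
inductive PPred
  | iri (s : Str)
  | var (x : Var)

/-- The variables of a subject or an object of a triple pattern. -/
def PTerm.vars {D : Type u} : PTerm D → Set Var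
  | .iri _ => ∅
  | .lit _ => ∅
  | .var x => {x}

/-- The variables of a predicate of a triple pattern. -/
def PPred.vars : PPred → Set Var
  | .iri _ => ∅
  | .var x => {x}

/-- Replacement of variables according to a mapping. -/
def PTerm.subst {D : Type u} (μ : Mapping D) : PTerm D → Option (Term D)
  | .iri s => some (.node (.iri s))
  | .lit d => some (.lit d)
  | .var x => μ x

/-- Replacement of variables according to a mapping. -/
def PPred.subst {D : Type u} (μ : Mapping D) : PPred → Option (Term D)
  | .iri s => some (.node (.iri s))
  | .var x => μ x

/-- Built-in conditions. The constants are IRIs and literals. -/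
inductive Cond (D : Type u)
  | bound (x : Var)
  | eqIRI (x : Var) (c : Str)
  | eqLit (x : Var) (c : D)
  | eqVar (x y : Var)
  | not (c : Cond D)
  | or (c₁ c₂ : Cond D)
  | and (c₁ c₂ : Cond D)

/-- The variables of a built-in condition. -/
def Cond.vars {D : Type u} : Cond D → Set Var
  | .bound x => {x}
  | .eqIRI x _ => {x}
  | .eqLit x _ => {x}
  | .eqVar x y => {x, y}
  | .not c => c.vars
  | .or c₁ c₂ => c₁.vars ∪ c₂.vars
  | .and c₁ c₂ => c₁.vars ∪ c₂.vars

/-- Satisfaction of a built-in condition by a mapping. -/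
def Cond.Sat {D : Type u} (μ : Mapping D) : Cond D → Prop
  | .bound x => x ∈ μ.dom
  | .eqIRI x c => μ x = some (.node (.iri c))
  | .eqLit x c => μ x = some (.lit c)
  | .eqVar x y => x ∈ μ.dom ∧ y ∈ μ.dom ∧ μ x = μ y
  | .not c => ¬ c.Sat μ
  | .or c₁ c₂ => c₁.Sat μ ∨ c₂.Sat μ
  | .and c₁ c₂ => c₁.Sat μ ∧ c₂.Sat μ

/-- Graph patterns. In `select ren keep P`, the list `ren` holds the pairs `?A AS ?B` and the
list `keep` holds the variables that are selected without renaming. -/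
inductive Pattern (D : Type u)
  | empty
  | triple (s : PTerm D) (p : PPred) (o : PTerm D)
  | and (P₁ P₂ : Pattern D)
  | opt (P₁ P₂ : Pattern D)
  | union (P₁ P₂ : Pattern D)
  | minus (P₁ P₂ : Pattern D)
  | filter (P : Pattern D) (c : Cond D)
  | select (ren : List (Var × Var)) (keep : List Var) (P : Pattern D)

namespace Pattern

variable {D : Type u}

/-- The variables in the list of a `SELECT` operator. -/
def selectVars (ren : List (Var × Var)) (keep : List Var) : List Var :=
  ren.map Prod.fst ++ ren.map Prod.snd ++ keep

/-- The variables that occur in a graph pattern. -/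
def vars : Pattern D → Set Var
  | .empty => ∅
  | .triple s p o => s.vars ∪ p.vars ∪ o.vars
  | .and P₁ P₂ => P₁.vars ∪ P₂.vars
  | .opt P₁ P₂ => P₁.vars ∪ P₂.vars
  | .union P₁ P₂ => P₁.vars ∪ P₂.vars
  | .minus P₁ P₂ => P₁.vars ∪ P₂.vars
  | .filter P c => P.vars ∪ c.vars
  | .select ren keep P => {x | x ∈ selectVars ren keep} ∪ P.vars

/-- The formation rule of the `SELECT` operator holds throughout the pattern: the variables in the
list of a `SELECT` are pairwise distinct, and the new names do not occur in its argument. -/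
def WellFormed : Pattern D → Prop
  | .empty => True
  | .triple _ _ _ => True
  | .and P₁ P₂ => P₁.WellFormed ∧ P₂.WellFormed
  | .opt P₁ P₂ => P₁.WellFormed ∧ P₂.WellFormed
  | .union P₁ P₂ => P₁.WellFormed ∧ P₂.WellFormed
  | .minus P₁ P₂ => P₁.WellFormed ∧ P₂.WellFormed
  | .filter P _ => P.WellFormed
  | .select ren keep P =>
      (selectVars ren keep).Nodup ∧ (∀ B ∈ ren.map Prod.snd, B ∉ P.vars) ∧ P.WellFormed

/-- The condition of being non-parametric for a part of a larger pattern, `out` being the set of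
variables that occur in the larger pattern outside this part: a variable in the argument of a
`SELECT` that is not one of the `?Aᵢ`, `?Cⱼ` selected there does not occur outside this `SELECT`. -/
def NonParametricIn : Pattern D → Set Var → Prop
  | .empty, _ => True
  | .triple _ _ _, _ => True
  | .and P₁ P₂, out => P₁.NonParametricIn (out ∪ P₂.vars) ∧ P₂.NonParametricIn (out ∪ P₁.vars)
  | .opt P₁ P₂, out => P₁.NonParametricIn (out ∪ P₂.vars) ∧ P₂.NonParametricIn (out ∪ P₁.vars)
  | .union P₁ P₂, out => P₁.NonParametricIn (out ∪ P₂.vars) ∧ P₂.NonParametricIn (out ∪ P₁.vars)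
  | .minus P₁ P₂, out => P₁.NonParametricIn (out ∪ P₂.vars) ∧ P₂.NonParametricIn (out ∪ P₁.vars)
  | .filter P c, out => P.NonParametricIn (out ∪ c.vars)
  | .select ren keep P, out =>
      (∀ x ∈ P.vars, x ∉ ren.map Prod.fst → x ∉ keep → x ∉ out) ∧
      P.NonParametricIn (out ∪ {x | x ∈ selectVars ren keep})

/-- Non-parametric graph patterns, for which the semantics of nested `SELECT` is defined. -/
def NonParametric (P : Pattern D) : Prop := P.NonParametricIn ∅

/-- The evaluation of a graph pattern over an RDF graph. -/
def eval (G : Graph D) : Pattern D → Set (Mapping D)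
  | .empty => {μ | μ = Mapping.empty ∧ G.1.Nonempty}
  | .triple s p o =>
      {μ | μ.dom = (Pattern.triple s p o).vars ∧
        ∃ x ∈ G.1, s.subst μ = some (.node x.subj) ∧ p.subst μ = some (.node (.iri x.pred)) ∧
          o.subst μ = some x.obj}
  | .and P₁ P₂ =>
      {μ | ∃ μ₁ ∈ P₁.eval G, ∃ μ₂ ∈ P₂.eval G, μ₁.Compatible μ₂ ∧ μ = μ₁.union μ₂}
  | .opt P₁ P₂ =>
      {μ | ∃ μ₁ ∈ P₁.eval G, ∃ μ₂ ∈ P₂.eval G, μ₁.Compatible μ₂ ∧ μ = μ₁.union μ₂} ∪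
      {μ | μ ∈ P₁.eval G ∧ ∀ μ' ∈ P₂.eval G, ¬ μ.Compatible μ'}
  | .union P₁ P₂ => P₁.eval G ∪ P₂.eval G
  | .minus P₁ P₂ =>
      {μ | μ ∈ P₁.eval G ∧ ∀ μ' ∈ P₂.eval G, ¬ μ.Compatible μ' ∨ μ.dom ∩ μ'.dom = ∅}
  | .filter P c => {μ | μ ∈ P.eval G ∧ c.Sat μ}
  | .select ren keep P =>
      {μ | ∃ μ' ∈ P.eval G, μ = (μ'.restrict (ren.map Prod.fst ++ keep)).rename ren}

end Pattern

/-- SPARQL queries: well-formed, non-parametric graph patterns. -/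
abbrev Query (D : Type u) := {P : Pattern D // P.WellFormed ∧ P.NonParametric}

/-- The set of answers of a SPARQL query over an RDF graph. -/
def Query.answers {D : Type u} (Q : Query D) (G : Graph D) : Set (Mapping D) := Q.1.eval G

/-! Direct mappings and query preservation. -/

/-- The mapping `tr(t)`: it is defined on the `?A` with `t.A ≠ NULL`, with value `t.A`. -/
def tr {D : Type u} {U : Finset Name} (t : Tuple D U) : Mapping D :=
  fun A => (t.val A).map Term.lit

/-- Direct mappings: functions from triples of a schema, a set of primary and foreign keys and an
instance to RDF graphs. -/
abbrev DirectMapping (D : Type u) :=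
  (S : Schema) → Constraints S → Instance D S → Graph D

/-- Query preservation. -/
def QueryPreserving {D : Type u} (M : DirectMapping D) : Prop :=
  ∀ (S : Schema) (C : Constraints S) (U : Finset Name) (Q : RA D S U),
    ∃ Qstar : Query D, ∀ I : Instance D S, I.Sat C → tr '' Q.eval I = Qstar.answers (M S C I)

/-! The direct mapping `DM`. First, the predicates that store the schema and the instance. -/

/-- `PK(As, r)`. -/
def Constraints.PK {S : Schema} (C : Constraints S) (As : List Name) (r : S.Rel) : Prop :=
  ∃ k ∈ C.keys, k.rel = r ∧ k.attrs = As

/-- `FK(As, r, Bs, s)`. -/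
def Constraints.FK {S : Schema} (C : Constraints S) (As : List Name) (r : S.Rel)
    (Bs : List Name) (s : S.Rel) : Prop :=
  ∃ f ∈ C.fks, f.src = r ∧ f.srcAttrs = As ∧ f.dst = s ∧ f.dstAttrs = Bs

/-- `Value(v, A, t, r)`. The tuple `t` itself is used as its identifier here. -/
def Instance.Value {D : Type u} {S : Schema} (I : Instance D S) (v : Option D) (A : Name)
    {r : S.Rel} (t : Tuple D (S.att r)) : Prop :=
  t ∈ I.rel r ∧ A ∈ S.att r ∧ t.val A = v

namespace Constraints

variable {S : Schema} (C : Constraints S)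

/-- `ThreeAttr(r)`: the relation has at least three attributes. -/
def ThreeAttr (r : S.Rel) : Prop :=
  ∃ x ∈ S.att r, ∃ y ∈ S.att r, ∃ z ∈ S.att r, x ≠ y ∧ x ≠ z ∧ y ≠ z

/-- `TwoFK(A, r)`: the attribute is the attribute of two distinct foreign keys. -/
def TwoFK (A : Name) (r : S.Rel) : Prop :=
  ∃ B₁ s₁ B₂ s₂, C.FK [A] r [B₁] s₁ ∧ C.FK [A] r [B₂] s₂ ∧ (B₁ ≠ B₂ ∨ s₁ ≠ s₂)

/-- `FKFrom(A, B, r)`: the two attributes are those of a composite foreign key. -/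
def FKFrom (A B : Name) (r : S.Rel) : Prop :=
  ∃ B₁ B₂ s, C.FK [A, B] r [B₁, B₂] s ∨ C.FK [B, A] r [B₁, B₂] s

/-- `FKTo(r)`: a relation with two attributes has an incoming foreign key. -/
def FKTo (r : S.Rel) : Prop :=
  (∃ A s B, C.FK [A] s [B] r) ∨ ∃ A₁ A₂ s B₁ B₂, C.FK [A₁, A₂] s [B₁, B₂] r

/-- `BinRel(r, A, B, s, A', t, B')`: `r` is a binary relation between `s` and `t`, with attribute
`A` referencing the attribute `A'` of `s`, and `B` referencing the attribute `B'` of `t`. -/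
def BinRel (r : S.Rel) (A B : Name) (s : S.Rel) (A' : Name) (t : S.Rel) (B' : Name) : Prop :=
  C.PK [A, B] r ∧ ¬ ThreeAttr r ∧ C.FK [A] r [A'] s ∧ r ≠ s ∧ C.FK [B] r [B'] t ∧ r ≠ t ∧
    ¬ C.TwoFK A r ∧ ¬ C.TwoFK B r ∧ ¬ C.FKFrom A B r ∧ ¬ C.FKTo r

/-- `IsBinRel(r)`. -/
def IsBinRel (r : S.Rel) : Prop := ∃ A B s A' t B', C.BinRel r A B s A' t B'

/-- `Class(r)`: every relation that is not a binary relation is a class. -/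
def Class (r : S.Rel) : Prop := ¬ C.IsBinRel r

/-- `OP(As, Bs, s, t)`: object properties that are generated from foreign keys. -/
def ObjProp (As Bs : List Name) (s t : S.Rel) : Prop := C.FK As s Bs t ∧ ¬ C.IsBinRel s

/-- `DTP(A, r)`: data type properties. -/
def DTProp (A : Name) (r : S.Rel) : Prop := A ∈ S.att r ∧ ¬ C.IsBinRel r

/-- `HasPK(r)`. -/
def HasPK (r : S.Rel) : Prop := ∃ As, C.PK As r

end Constraints

/-- The data that the generation of IRIs and blank nodes depends on: the base IRI, the lexical
forms of the constants, and the choice of identifiers for the tuples of an instance. -/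
structure Encoding (D : Type u) where
  base : Str
  lex : D → Name
  tupleId : (S : Schema) → Instance D S → (r : S.Rel) → Tuple D (S.att r) → Str

namespace Encoding

variable {D : Type u} (E : Encoding D)

/-- The string for an element of `D ∪ {NULL}`. -/
def lexNull : Option D → Name
  | none => nullName
  | some d => E.lex d

/-- `base r` -/
def classIRI (r : Name) : Str := E.base ++ r.1

/-- `base r # A` -/
def dtpIRI (A r : Name) : Str := E.base ++ r.1 ++ [hash] ++ A.1

/-- `base r # A , B , A' , B'` -/
def binIRI (r A B A' B' : Name) : Str :=
  E.base ++ r.1 ++ [hash] ++ A.1 ++ [comma] ++ B.1 ++ [comma] ++ A'.1 ++ [comma] ++ B'.1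

/-- `base s , t # A₁ , … , Aₙ , B₁ , … , Bₙ` -/
def fkIRI (As Bs : List Name) (s t : Name) : Str :=
  E.base ++ s.1 ++ [comma] ++ t.1 ++ [hash] ++
    [comma].intercalate ((As ++ Bs).map Subtype.val)

/-- `base r # A₁ = v₁ , … , Aₙ = vₙ` -/
def rowIRI (r : Name) (As : List Name) (vs : List (Option D)) : Str :=
  E.base ++ r.1 ++ [hash] ++
    [comma].intercalate (List.zipWith (fun A v => A.1 ++ [equals] ++ (E.lexNull v).1) As vs)

/-- The label `_: r id` of the blank node for a tuple, where `id` is its identifier. -/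
def rowBlank {S : Schema} (I : Instance D S) {r : S.Rel} (t : Tuple D (S.att r)) : Str :=
  ofCodes [95, 58] ++ r.1.1 ++ E.tupleId S I r t

/-- The conventions on the generation of IRIs and blank nodes: different constants have different
lexical forms, the base IRI does not begin an IRI of the RDF, RDFS and OWL vocabulary, and the
blank nodes for different tuples of an instance are different. -/
structure Admissible : Prop where
  lex_injective : Function.Injective E.lex
  base_not_prefix : ∀ w ∈ vocabulary, ¬ E.base <+: w
  rowBlank_injective : ∀ (S : Schema) (I : Instance D S) (r r' : S.Rel)
    (t : Tuple D (S.att r)) (t' : Tuple D (S.att r')), t ∈ I.rel r → t' ∈ I.rel r' →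
    E.rowBlank I t = E.rowBlank I t' →
    (⟨r, t⟩ : (r : S.Rel) × Tuple D (S.att r)) = ⟨r', t'⟩

end Encoding

section Rules

variable {D : Type u} (E : Encoding D) {S : Schema} (C : Constraints S) (I : Instance D S)

/-- `ID(t, r, x)`: the node `x` is the identifier of the tuple `t` of `r`, an IRI if `r` has a
primary key and a blank node otherwise. -/
inductive TupleNode : (r : S.Rel) → Tuple D (S.att r) → Node → Prop
  | row {r : S.Rel} {t : Tuple D (S.att r)} {As : List Name} {vs : List (Option D)} :
      C.Class r → C.PK As r → List.Forall₂ (fun v A => I.Value v A t) vs As →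
      TupleNode r t (.iri (E.rowIRI r.1 As vs))
  | blank {r : S.Rel} {t : Tuple D (S.att r)} {v : Option D} {A : Name} :
      C.Class r → ¬ C.HasPK r → I.Value v A t →
      TupleNode r t (.blank (E.rowBlank I t))

/-- The rules that generate the triples of the direct mapping. -/
inductive IsTriple : Triple D → Prop
  | classDecl {r : S.Rel} : C.Class r →
      IsTriple ⟨.iri (E.classIRI r.1), rdfType, .node (.iri owlClass)⟩
  | objPropDecl {As Bs : List Name} {s t : S.Rel} : C.ObjProp As Bs s t →
      IsTriple ⟨.iri (E.fkIRI As Bs s.1 t.1), rdfType, .node (.iri owlObjectProperty)⟩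
  | objPropDomain {As Bs : List Name} {s t : S.Rel} : C.ObjProp As Bs s t → C.Class s →
      IsTriple ⟨.iri (E.fkIRI As Bs s.1 t.1), rdfsDomain, .node (.iri (E.classIRI s.1))⟩
  | objPropRange {As Bs : List Name} {s t : S.Rel} : C.ObjProp As Bs s t → C.Class t →
      IsTriple ⟨.iri (E.fkIRI As Bs s.1 t.1), rdfsRange, .node (.iri (E.classIRI t.1))⟩
  | dtPropDecl {A : Name} {r : S.Rel} : C.DTProp A r →
      IsTriple ⟨.iri (E.dtpIRI A r.1), rdfType, .node (.iri owlDatatypeProperty)⟩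
  | dtPropDomain {A : Name} {r : S.Rel} : C.DTProp A r → C.Class r →
      IsTriple ⟨.iri (E.dtpIRI A r.1), rdfsDomain, .node (.iri (E.classIRI r.1))⟩
  | table {v : Option D} {A : Name} {r : S.Rel} {t : Tuple D (S.att r)} {u : Node} :
      I.Value v A t → TupleNode E C I r t u → C.Class r →
      IsTriple ⟨u, rdfType, .node (.iri (E.classIRI r.1))⟩
  | binRef {r s t : S.Rel} {A B A' B' : Name} {v₁ v₂ : Option D} {x₁ : Tuple D (S.att r)}
      {x₂ : Tuple D (S.att s)} {x₃ : Tuple D (S.att t)} {u w : Node} :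
      C.BinRel r A B s A' t B' →
      I.Value v₁ A x₁ → I.Value v₁ A' x₂ → I.Value v₂ B x₁ → I.Value v₂ B' x₃ →
      TupleNode E C I s x₂ u → TupleNode E C I t x₃ w →
      IsTriple ⟨u, E.binIRI r.1 A B A' B', .node w⟩
  | fkRef {As Bs : List Name} {s t : S.Rel} {vs : List (Option D)} {x₁ : Tuple D (S.att s)}
      {x₂ : Tuple D (S.att t)} {u w : Node} :
      C.ObjProp As Bs s t →
      List.Forall₂ (fun v A => I.Value v A x₁) vs As →
      List.Forall₂ (fun v B => I.Value v B x₂) vs Bs →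
      TupleNode E C I s x₁ u → TupleNode E C I t x₂ w →
      IsTriple ⟨u, E.fkIRI As Bs s.1 t.1, .node w⟩
  | literal {A : Name} {r : S.Rel} {t : Tuple D (S.att r)} {d : D} {u : Node} :
      C.DTProp A r → I.Value (some d) A t → TupleNode E C I r t u →
      IsTriple ⟨u, E.dtpIRI A r.1, .lit d⟩

theorem fk_finite : {p : (List Name × List Name) × S.Rel × S.Rel |
    C.FK p.1.1 p.2.1 p.1.2 p.2.2}.Finite := by
  refine ((C.fks.finite_toSet).image
    fun f => ((f.srcAttrs, f.dstAttrs), f.src, f.dst)).subset ?_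
  rintro ⟨⟨As, Bs⟩, s, t⟩ ⟨f, hf, h1, h2, h3, h4⟩
  refine ⟨f, hf, ?_⟩
  simp only at h1 h2 h3 h4
  simp [h1, h2, h3, h4]

theorem forall₂_value {r : S.Rel} {t : Tuple D (S.att r)} {As : List Name}
    {vs : List (Option D)} (h : List.Forall₂ (fun v A => I.Value v A t) vs As) :
    vs = As.map t.val := by
  induction h with
  | nil => rfl
  | cons h _ ih => rw [List.map_cons, ← ih, h.2.2]

theorem tuples_finite : {p : (r : S.Rel) × Tuple D (S.att r) | p.2 ∈ I.rel p.1}.Finite := by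
  refine (Set.finite_iUnion fun r => (I.finite r).image (Sigma.mk r)).subset ?_
  rintro ⟨r, t⟩ h
  exact Set.mem_iUnion.2 ⟨r, t, h, rfl⟩

theorem tupleNode_mem {r : S.Rel} {t : Tuple D (S.att r)} {x : Node}
    (h : TupleNode E C I r t x) : t ∈ I.rel r := by
  cases h with
  | row _ hk hv =>
    obtain ⟨k, _, _, hk⟩ := hk
    cases hv with
    | nil => exact absurd hk k.attrs_ne_nil
    | cons h _ => exact h.1
  | blank _ _ h => exact h.1

theorem tupleNode_finite :
    {x : Node | ∃ (r : S.Rel) (t : Tuple D (S.att r)), TupleNode E C I r t x}.Finite := by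
  have h1 := (tuples_finite I).image fun p => Node.blank (E.rowBlank I p.2)
  have h2 := ((C.keys.finite_toSet).prod (tuples_finite I)).image
    fun p => Node.iri (E.rowIRI p.2.1.1 p.1.attrs (p.1.attrs.map p.2.2.val))
  refine (h1.union h2).subset ?_
  rintro x ⟨r, t, h⟩
  have ht := tupleNode_mem E C I h
  cases h with
  | row _ hk hv =>
    obtain ⟨k, hk, _, rfl⟩ := hk
    exact Or.inr ⟨⟨k, ⟨r, t⟩⟩, ⟨hk, ht⟩, by rw [forall₂_value I hv]⟩
  | blank _ _ _ => exact Or.inl ⟨⟨r, t⟩, ht, rfl⟩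

theorem iris_finite : ∃ P : Set Str, P.Finite ∧ (∀ w ∈ vocabulary, w ∈ P) ∧
    (∀ r : S.Rel, E.classIRI r.1 ∈ P) ∧
    (∀ (A : Name) (r : S.Rel), C.DTProp A r → E.dtpIRI A r.1 ∈ P) ∧
    (∀ (As Bs : List Name) (s t : S.Rel), C.ObjProp As Bs s t → E.fkIRI As Bs s.1 t.1 ∈ P) ∧
    (∀ (r s t : S.Rel) (A B A' B' : Name), C.BinRel r A B s A' t B' →
      E.binIRI r.1 A B A' B' ∈ P) := by
  have hF := (fk_finite C).image fun p => E.fkIRI p.1.1 p.1.2 p.2.1.1 p.2.2.1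
  have hC : (Set.range fun r : S.Rel => E.classIRI r.1).Finite := Set.finite_range _
  have hA : (Set.range fun p : (r : S.Rel) × {A // A ∈ S.att r} =>
      E.dtpIRI p.2.1 p.1.1).Finite := Set.finite_range _
  have hB : (Set.range fun p : ((r : S.Rel) × ({A // A ∈ S.att r} × {A // A ∈ S.att r})) ×
      ((r : S.Rel) × {A // A ∈ S.att r}) × ((r : S.Rel) × {A // A ∈ S.att r}) =>
      E.binIRI p.1.1.1 p.1.2.1.1 p.1.2.2.1 p.2.1.2.1 p.2.2.2.1).Finite := Set.finite_range _
  have hV : {w | w ∈ vocabulary}.Finite := List.finite_toSet _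
  refine ⟨_, hV.union (hC.union (hA.union (hF.union hB))), ?_, ?_, ?_, ?_, ?_⟩
  · exact fun w hw => Or.inl hw
  · exact fun r => Or.inr (Or.inl ⟨r, rfl⟩)
  · exact fun A r h => Or.inr (Or.inr (Or.inl ⟨⟨r, ⟨A, h.1⟩⟩, rfl⟩))
  · exact fun As Bs s t h => Or.inr (Or.inr (Or.inr (Or.inl ⟨((As, Bs), s, t), h.1, rfl⟩)))
  · rintro r s t A B A' B' ⟨⟨k, _, rfl, hk⟩, _, ⟨f, _, _, _, rfl, hf⟩, _, ⟨g, _, _, _, rfl, hg⟩, _⟩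
    have h1 : A ∈ S.att k.rel := k.attrs_mem A (by simp [hk])
    have h2 : B ∈ S.att k.rel := k.attrs_mem B (by simp [hk])
    have h3 : A' ∈ S.att f.dst := f.dstAttrs_mem A' (by simp [hf])
    have h4 : B' ∈ S.att g.dst := g.dstAttrs_mem B' (by simp [hg])
    exact Or.inr (Or.inr (Or.inr (Or.inr
      ⟨(⟨k.rel, ⟨A, h1⟩, ⟨B, h2⟩⟩, ⟨f.dst, ⟨A', h3⟩⟩, ⟨g.dst, ⟨B', h4⟩⟩), rfl⟩)))

theorem literals_finite :
    {d : D | ∃ (r : S.Rel) (t : Tuple D (S.att r)) (A : Name), I.Value (some d) A t}.Finite := by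
  have h := (tuples_finite I).biUnion fun p _ => Set.finite_range p.2
  refine (h.preimage (Option.some_injective D).injOn).subset ?_
  rintro d ⟨r, t, A, ht, hA, hv⟩
  refine Set.mem_biUnion (x := ⟨r, t⟩) ht ⟨⟨A, hA⟩, ?_⟩
  rw [← hv, Tuple.val, dif_pos hA]

/-- The direct mapping generates finitely many triples. -/
theorem isTriple_finite : {x | IsTriple E C I x}.Finite := by
  obtain ⟨P, hP, hV, hC, hA, hF, hB⟩ := iris_finite E C
  have hV' : rdfType ∈ P ∧ owlClass ∈ P ∧ owlObjectProperty ∈ P ∧ owlDatatypeProperty ∈ P ∧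
      rdfsDomain ∈ P ∧ rdfsRange ∈ P := by
    refine ⟨?_, ?_, ?_, ?_, ?_, ?_⟩ <;> exact hV _ (by simp [vocabulary])
  obtain ⟨v1, v2, v3, v4, v5, v6⟩ := hV'
  have hS := (tupleNode_finite E C I).union (hP.image Node.iri)
  have hO := (hS.image (Term.node (D := D))).union ((literals_finite I).image Term.lit)
  refine (((hS.prod (hP.prod hO))).image fun p => (⟨p.1, p.2.1, p.2.2⟩ : Triple D)).subset ?_
  have io {w : Str} (h : w ∈ P) : Node.iri w ∈ {x : Node | ∃ (r : S.Rel)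
      (t : Tuple D (S.att r)), TupleNode E C I r t x} ∪ Node.iri '' P := Or.inr ⟨w, h, rfl⟩
  intro x hx
  cases hx with
  | classDecl _ => exact ⟨(_, _, _),
      ⟨(io (hC _)), v1, (Or.inl ⟨_, io v2, rfl⟩)⟩, rfl⟩
  | objPropDecl h => exact ⟨(_, _, _),
      ⟨(io (hF _ _ _ _ h)), v1, (Or.inl ⟨_, io v3, rfl⟩)⟩, rfl⟩
  | objPropDomain h _ => exact ⟨(_, _, _),
      ⟨(io (hF _ _ _ _ h)), v5, (Or.inl ⟨_, io (hC _), rfl⟩)⟩, rfl⟩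
  | objPropRange h _ => exact ⟨(_, _, _),
      ⟨(io (hF _ _ _ _ h)), v6, (Or.inl ⟨_, io (hC _), rfl⟩)⟩, rfl⟩
  | dtPropDecl h => exact ⟨(_, _, _),
      ⟨(io (hA _ _ h)), v1, (Or.inl ⟨_, io v4, rfl⟩)⟩, rfl⟩
  | dtPropDomain h _ => exact ⟨(_, _, _),
      ⟨(io (hA _ _ h)), v5, (Or.inl ⟨_, io (hC _), rfl⟩)⟩, rfl⟩
  | table _ h _ => exact ⟨(_, _, _),
      ⟨(Or.inl ⟨_, _, h⟩), v1, (Or.inl ⟨_, io (hC _), rfl⟩)⟩, rfl⟩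
  | binRef h _ _ _ _ h1 h2 =>
    exact ⟨(_, _, _),
      ⟨(Or.inl ⟨_, _, h1⟩), (hB _ _ _ _ _ _ _ h), (Or.inl ⟨_, Or.inl ⟨_, _, h2⟩, rfl⟩)⟩, rfl⟩
  | fkRef h _ _ h1 h2 =>
    exact ⟨(_, _, _),
      ⟨(Or.inl ⟨_, _, h1⟩), (hF _ _ _ _ h), (Or.inl ⟨_, Or.inl ⟨_, _, h2⟩, rfl⟩)⟩, rfl⟩
  | literal h hv h1 =>
    exact ⟨(_, _, _),
      ⟨(Or.inl ⟨_, _, h1⟩), (hA _ _ h), (Or.inr ⟨_, ⟨_, _, _, hv⟩, rfl⟩)⟩, rfl⟩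
end Rules

/-- The direct mapping `DM`. -/
def DM {D : Type u} (E : Encoding D) : DirectMapping D :=
  fun _ C I => ⟨{x | IsTriple E C I x}, isTriple_finite E C I⟩

end DirectMap

/-!
A relational algebra query is translated by structural induction, a tuple `t` of a subquery being
represented by the mapping `tr t`. The point that makes the induction compositional is that the
internal variables of a pattern do not matter: `Expressible G V S` says that some pattern has the
answers `S i` over each graph `G i`, that these answers only bind variables of `V`, and that every
other variable of the pattern is hidden by a `SELECT` inside it. Evaluation commutes with
permutations of the variables (`Pattern.mem_eval_map`), so the hidden variables can be moved away
from any finite set (`Expressible.exists_pattern`). Hence expressible families are closed under the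
operators of SPARQL with no side condition on names, and `SELECT ... AS` is not needed: renaming an
attribute is the exchange of two variables.

The relations are recovered from the graph as follows. Names contain no delimiter and the base IRI
does not begin a vocabulary IRI, so the predicate of a triple (for `rdf:type`, with its object)
tells which rule of the mapping produced it, and a node determines its tuple (`TupleNode.inj`).
The tuples of a class are the nodes of that type, extended by one `OPT` for each attribute, where
null values leave variables unbound (`expressible_class`). A tuple of a binary relation refers to
tuples of two classes, as its key excludes null values; it is read off the link between their nodes
and the referenced attributes of these (`expressible_binRel`).

Most operators of relational algebra have a direct counterpart. A join needs the common variables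
to be bound on both sides. In a difference, `MINUS` compares mappings up to compatibility and
ignores those with disjoint domains. Both effects are avoided by treating each possible domain
separately, and by adding to both sides a common variable that ranges over the classes; since a
relation that a binary relation refers to is a class, there is always one
(`Expressible.diff`, `Constraints.exists_class`).
-/

namespace DirectMap

universe u

variable {D : Type u}

/-! ### Renaming the variables of a pattern -/

/-- Renaming of variables in a subject or an object. -/
def PTerm.map (ρ : Var → Var) : PTerm D → PTerm D
  | .iri s => .iri s
  | .lit d => .lit d
  | .var x => .var (ρ x)

/-- Renaming of variables in a predicate. -/
def PPred.map (ρ : Var → Var) : PPred → PPred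
  | .iri s => .iri s
  | .var x => .var (ρ x)

/-- Renaming of variables in a built-in condition. -/
def Cond.map (ρ : Var → Var) : Cond D → Cond D
  | .bound x => .bound (ρ x)
  | .eqIRI x c => .eqIRI (ρ x) c
  | .eqLit x c => .eqLit (ρ x) c
  | .eqVar x y => .eqVar (ρ x) (ρ y)
  | .not c => .not (c.map ρ)
  | .or c₁ c₂ => .or (c₁.map ρ) (c₂.map ρ)
  | .and c₁ c₂ => .and (c₁.map ρ) (c₂.map ρ)

/-- Renaming of all variables of a graph pattern, including those that a `SELECT` hides. -/
def Pattern.map (ρ : Var → Var) : Pattern D → Pattern D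
  | .empty => .empty
  | .triple s p o => .triple (s.map ρ) (p.map ρ) (o.map ρ)
  | .and P₁ P₂ => .and (P₁.map ρ) (P₂.map ρ)
  | .opt P₁ P₂ => .opt (P₁.map ρ) (P₂.map ρ)
  | .union P₁ P₂ => .union (P₁.map ρ) (P₂.map ρ)
  | .minus P₁ P₂ => .minus (P₁.map ρ) (P₂.map ρ)
  | .filter P c => .filter (P.map ρ) (c.map ρ)
  | .select ren keep P => .select (ren.map (Prod.map ρ ρ)) (keep.map ρ) (P.map ρ)

theorem PTerm.vars_map (ρ : Var → Var) (s : PTerm D) : (s.map ρ).vars = ρ '' s.vars := by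
  cases s <;> simp [PTerm.map, PTerm.vars]

theorem PPred.vars_map (ρ : Var → Var) (s : PPred) : (s.map ρ).vars = ρ '' s.vars := by
  cases s <;> simp [PPred.map, PPred.vars]

theorem Cond.vars_map (ρ : Var → Var) (c : Cond D) : (c.map ρ).vars = ρ '' c.vars := by
  induction c <;> simp_all [Cond.map, Cond.vars, Set.image_union, Set.image_pair]

theorem PTerm.vars_finite (s : PTerm D) : s.vars.Finite := by cases s <;> simp [PTerm.vars]

theorem PPred.vars_finite (s : PPred) : s.vars.Finite := by cases s <;> simp [PPred.vars]

theorem Cond.vars_finite (c : Cond D) : c.vars.Finite := by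
  induction c <;> simp_all [Cond.vars]

namespace Pattern

theorem selectVars_map (ρ : Var → Var) (ren : List (Var × Var)) (keep : List Var) :
    selectVars (ren.map (Prod.map ρ ρ)) (keep.map ρ) = (selectVars ren keep).map ρ := by
  simp [selectVars, Function.comp_def]

theorem setOf_mem_map (ρ : Var → Var) (l : List Var) : {x | x ∈ l.map ρ} = ρ '' {x | x ∈ l} := by
  ext x; simp

theorem vars_map (ρ : Var → Var) (P : Pattern D) : (P.map ρ).vars = ρ '' P.vars := by
  induction P with
  | select ren keep P ih =>
    rw [map, vars, vars, selectVars_map, ih, Set.image_union, setOf_mem_map]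
  | _ => simp_all [map, vars, Set.image_union, PTerm.vars_map, PPred.vars_map, Cond.vars_map]

theorem vars_finite (P : Pattern D) : P.vars.Finite := by
  induction P with
  | select ren keep P ih => exact (List.finite_toSet _).union ih
  | triple s p o => exact (s.vars_finite.union p.vars_finite).union o.vars_finite
  | _ => simp_all [vars, Cond.vars_finite]

theorem WellFormed.map (ρ : Equiv.Perm Var) {P : Pattern D} (h : P.WellFormed) :
    (P.map ρ).WellFormed := by
  induction P with
  | select ren keep P ih =>
    obtain ⟨h₁, h₂, h₃⟩ := h
    refine ⟨?_, ?_, ih h₃⟩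
    · rw [selectVars_map]
      exact h₁.map ρ.injective
    · rw [vars_map]
      intro B hB
      obtain ⟨p, hp, rfl⟩ := List.mem_map.1 hB
      obtain ⟨q, hq, rfl⟩ := List.mem_map.1 hp
      simpa using h₂ q.2 (List.mem_map_of_mem hq)
  | filter P c ih => exact ih h
  | empty => trivial
  | triple s p o => trivial
  | _ P₁ P₂ ih₁ ih₂ => exact ⟨ih₁ h.1, ih₂ h.2⟩

theorem NonParametricIn.map (ρ : Equiv.Perm Var) {P : Pattern D} {out : Set Var}
    (h : P.NonParametricIn out) : (P.map ρ).NonParametricIn (ρ '' out) := by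
  induction P generalizing out with
  | select ren keep P ih =>
    obtain ⟨h₁, h₂⟩ := h
    refine ⟨?_, ?_⟩
    · rw [vars_map]
      rintro _ ⟨x, hx, rfl⟩ hr hk
      rw [ρ.injective.mem_set_image]
      refine h₁ x hx (fun h => hr ?_) (fun h => hk (List.mem_map_of_mem h))
      obtain ⟨p, hp, rfl⟩ := List.mem_map.1 h
      exact List.mem_map.2 ⟨_, List.mem_map_of_mem hp, rfl⟩
    · have := ih h₂
      rwa [Set.image_union, ← setOf_mem_map, ← selectVars_map] at this
  | filter P c ih =>
    have := ih h
    rwa [Set.image_union, ← Cond.vars_map] at this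
  | empty => trivial
  | triple s p o => trivial
  | _ P₁ P₂ ih₁ ih₂ =>
    have h₁ := ih₁ h.1
    have h₂ := ih₂ h.2
    rw [Set.image_union, ← vars_map] at h₁ h₂
    exact ⟨h₁, h₂⟩

end Pattern

namespace Mapping

variable (ρ : Equiv.Perm Var)

theorem comp_surjective : Function.Surjective fun μ : Mapping D => (μ ∘ ρ : Mapping D) :=
  fun ν => ⟨ν ∘ ρ.symm, by ext1 x; simp⟩

theorem comp_injective : Function.Injective fun μ : Mapping D => (μ ∘ ρ : Mapping D) :=
  ρ.surjective.injective_comp_right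

theorem compatible_comp {μ ν : Mapping D} :
    Compatible (μ ∘ ρ) (ν ∘ ρ) ↔ μ.Compatible ν :=
  ⟨fun h x hx => by simpa using h (ρ.symm x) (by simpa [dom] using hx), fun h x hx => h (ρ x) hx⟩

theorem dom_inter_comp {μ ν : Mapping D} :
    dom (μ ∘ ρ) ∩ dom (ν ∘ ρ) = ∅ ↔ μ.dom ∩ ν.dom = ∅ := by
  change ρ ⁻¹' (μ.dom ∩ ν.dom) = ∅ ↔ _
  rw [Set.preimage_eq_empty_iff, ρ.range_eq_univ, Set.disjoint_univ]

theorem restrict_comp (μ : Mapping D) (W : List Var) :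
    (μ.restrict (W.map ρ)) ∘ ρ = restrict (μ ∘ ρ) W := by
  ext1 x; simp [restrict]

theorem rename_comp (μ : Mapping D) (l : List (Var × Var)) :
    (rename (l.map (Prod.map ρ ρ)) μ) ∘ ρ = rename l (μ ∘ ρ) := by
  ext1 x
  have h : (l.map (Prod.map ρ ρ)).find? (fun p => decide (p.2 = ρ x)) =
      (l.find? fun p => decide (p.2 = x)).map (Prod.map ρ ρ) := by
    rw [List.find?_map]
    congr 2
    ext p
    simp
  simp only [rename, Function.comp_apply, h]
  cases l.find? (fun p => decide (p.2 = x)) with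
  | some p => rfl
  | none =>
    have h : ρ x ∈ (l.map (Prod.map ρ ρ)).map Prod.fst ↔ x ∈ l.map Prod.fst := by
      rw [List.map_map, show Prod.fst ∘ Prod.map ρ ρ = ρ ∘ Prod.fst from rfl, ← List.map_map,
        List.mem_map_of_injective ρ.injective]
    simp only [h, Option.map_none]

end Mapping

theorem PTerm.subst_map (ρ : Var → Var) (μ : Mapping D) (s : PTerm D) :
    (s.map ρ).subst μ = s.subst (μ ∘ ρ) := by
  cases s <;> rfl

theorem PPred.subst_map (ρ : Var → Var) (μ : Mapping D) (s : PPred) :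
    (s.map ρ).subst μ = s.subst (μ ∘ ρ) := by
  cases s <;> rfl

theorem Cond.sat_map (ρ : Var → Var) (μ : Mapping D) (c : Cond D) :
    (c.map ρ).Sat μ ↔ c.Sat (μ ∘ ρ) := by
  induction c <;> simp_all [Cond.map, Cond.Sat, Mapping.dom]

/-- Evaluation commutes with permutations of the variables. -/
theorem Pattern.mem_eval_map (ρ : Equiv.Perm Var) (G : Graph D) (P : Pattern D) (μ : Mapping D) :
    μ ∈ (P.map ρ).eval G ↔ (μ ∘ ρ : Mapping D) ∈ P.eval G := by
  have hand (P₁ P₂ : Pattern D)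
      (ih₁ : ∀ μ : Mapping D, μ ∈ (P₁.map ρ).eval G ↔ (μ ∘ ρ : Mapping D) ∈ P₁.eval G)
      (ih₂ : ∀ μ : Mapping D, μ ∈ (P₂.map ρ).eval G ↔ (μ ∘ ρ : Mapping D) ∈ P₂.eval G)
      (μ : Mapping D) :
      μ ∈ ((P₁.and P₂).map ρ).eval G ↔ (μ ∘ ρ : Mapping D) ∈ (P₁.and P₂).eval G := by
    simp only [map, eval, Set.mem_ofPred_eq, ih₁, ih₂]
    refine Iff.trans ?_ (Mapping.comp_surjective ρ).exists.symm
    refine exists_congr fun μ₁ => and_congr_right fun _ => ?_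
    refine Iff.trans ?_ (Mapping.comp_surjective ρ).exists.symm
    refine exists_congr fun μ₂ => and_congr_right fun _ =>
      and_congr (Mapping.compatible_comp ρ).symm ?_
    exact (Mapping.comp_injective ρ).eq_iff.symm
  induction P generalizing μ with
  | empty =>
    simp only [map, eval, Set.mem_ofPred_eq]
    refine and_congr_left fun _ => ?_
    exact (Mapping.comp_injective ρ).eq_iff.symm
  | triple s p o =>
    simp only [map, eval, Set.mem_ofPred_eq, PTerm.subst_map, PPred.subst_map]
    refine and_congr_left fun _ => ?_
    have := vars_map ρ (triple s p o)
    rw [map] at this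
    rw [this]
    change _ ↔ ρ ⁻¹' μ.dom = _
    rw [ρ.preimage_eq_iff_eq_image]
  | and P₁ P₂ ih₁ ih₂ => exact hand P₁ P₂ ih₁ ih₂ μ
  | opt P₁ P₂ ih₁ ih₂ =>
    refine or_congr (hand P₁ P₂ ih₁ ih₂ μ) (and_congr (ih₁ μ) ?_)
    refine Iff.trans ?_ (Mapping.comp_surjective ρ).forall.symm
    exact forall_congr' fun ν => imp_congr (ih₂ ν) (not_congr (Mapping.compatible_comp ρ).symm)
  | union P₁ P₂ ih₁ ih₂ => exact or_congr (ih₁ μ) (ih₂ μ)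
  | minus P₁ P₂ ih₁ ih₂ =>
    refine and_congr (ih₁ μ) ?_
    refine Iff.trans ?_ (Mapping.comp_surjective ρ).forall.symm
    exact forall_congr' fun ν => imp_congr (ih₂ ν) (or_congr
      (not_congr (Mapping.compatible_comp ρ).symm) (Mapping.dom_inter_comp ρ).symm)
  | filter P c ih => exact and_congr (ih μ) (Cond.sat_map ρ μ c)
  | select ren keep P ih =>
    simp only [map, eval, Set.mem_ofPred_eq, ih]
    refine Iff.trans ?_ (Mapping.comp_surjective ρ).exists.symm
    refine exists_congr fun ν => and_congr_right fun _ => ?_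
    rw [← (Mapping.comp_injective ρ).eq_iff]
    have h : List.map Prod.fst (List.map (Prod.map ρ ρ) ren) ++ List.map ρ keep =
      (ren.map Prod.fst ++ keep).map ρ := by simp [Function.comp_def]
    rw [h, Mapping.rename_comp, Mapping.restrict_comp]

instance : Infinite Name :=
  Infinite.of_injective
    (fun n : ℕ => (⟨List.replicate n (Char.ofNat 97), by
      intro c hc
      rw [List.eq_of_mem_replicate hc]
      simp [IsDelimiter, hash, comma, equals]⟩ : Name))
    fun m n h => by simpa using congrArg (fun s : Name => s.1.length) h

/-- A finite set of variables can be moved away from the finite set `F` by a permutation that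
fixes the variables of `V`. -/
theorem exists_perm_avoiding (V F Y : Finset Var) (hY : Disjoint Y V) :
    ∃ ρ : Equiv.Perm Var, (∀ x ∈ V, ρ x = x) ∧ ∀ y ∈ Y, ρ y ∉ F := by
  induction Y using Finset.induction_on with
  | empty => exact ⟨1, by simp, by simp⟩
  | insert y Y hy ih =>
    rw [Finset.disjoint_insert_left] at hY
    obtain ⟨ρ, h₁, h₂⟩ := ih hY.2
    obtain ⟨z, hz⟩ := Infinite.exists_notMem_finset (F ∪ V ∪ Y.image ρ)
    simp only [Finset.mem_union, not_or] at hz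
    refine ⟨Equiv.swap (ρ y) z * ρ, fun x hx => ?_, fun w hw => ?_⟩
    · rw [Equiv.Perm.mul_apply, Equiv.swap_apply_of_ne_of_ne, h₁ x hx]
      · exact fun h => hY.1 (ρ.injective h ▸ hx)
      · rintro h
        rw [h₁ x hx] at h
        exact hz.1.2 (h ▸ hx)
    · rw [Equiv.Perm.mul_apply]
      rcases Finset.mem_insert.1 hw with rfl | hw
      · rw [Equiv.swap_apply_left]
        exact hz.1.1
      · rw [Equiv.swap_apply_of_ne_of_ne]
        · exact h₂ w hw
        · exact fun h => hy (ρ.injective h ▸ hw)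
        · rintro h
          exact hz.2 (h ▸ Finset.mem_image_of_mem ρ hw)

theorem Mapping.dom_union {μ ν : Mapping D} : (μ.union ν).dom = μ.dom ∪ ν.dom := by
  ext x
  simp only [Mapping.dom, Mapping.union, Set.mem_union, Set.mem_ofPred_eq]
  cases μ x <;> simp

/-! ### Families of answer sets that are expressible by patterns -/

/-- The pattern is well formed, and it is non-parametric as a part of every larger pattern in which
no variable of it occurs, except for those in `V`. -/
structure Pattern.Scoped (P : Pattern D) (V : Finset Var) : Prop where
  wellFormed : P.WellFormed
  nonParametricIn : ∀ out : Set Var, (∀ x ∈ out, x ∈ P.vars → x ∈ V) → P.NonParametricIn out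

/-- A pattern answers `S i` over each graph `G i` of the family. The variables of these answers
are in `V`, and every other variable of the pattern is hidden in it. -/
def Expressible {ι : Sort*} (G : ι → Graph D) (V : Finset Var) (S : ι → Set (Mapping D)) : Prop :=
  ∃ P : Pattern D, P.Scoped V ∧ ∀ i, P.eval (G i) = S i ∧ ∀ μ ∈ S i, μ.dom ⊆ V

namespace Expressible

variable {ι : Sort*} {G : ι → Graph D} {V W : Finset Var} {S T : ι → Set (Mapping D)}

theorem dom_subset (h : Expressible G V S) {i : ι} {μ : Mapping D} (hμ : μ ∈ S i) :
    μ.dom ⊆ V := by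
  obtain ⟨P, _, h⟩ := h
  exact (h i).2 μ hμ

theorem perm (ρ : Equiv.Perm Var) (h : Expressible G V S) :
    Expressible G (V.image ρ) fun i => {μ | (μ ∘ ρ : Mapping D) ∈ S i} := by
  obtain ⟨P, ⟨h₁, h₂⟩, h₃⟩ := h
  refine ⟨P.map ρ, ⟨h₁.map ρ, fun out hout => ?_⟩, fun i => ⟨?_, fun μ hμ => ?_⟩⟩
  · have := (h₂ (ρ ⁻¹' out) fun x hx hP => ?_).map ρ
    · rwa [Set.image_preimage_eq _ ρ.surjective] at this
    · have := hout (ρ x) hx (by rw [Pattern.vars_map]; exact Set.mem_image_of_mem ρ hP)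
      simpa using this
  · ext μ
    rw [Pattern.mem_eval_map, (h₃ i).1]
    rfl
  · intro x hx
    have : ρ.symm x ∈ (V : Set Var) := (h₃ i).2 _ hμ (by simpa [Mapping.dom] using hx)
    exact Finset.mem_coe.2 (Finset.mem_image.2 ⟨_, this, by simp⟩)

/-- The hidden variables can be chosen outside of any given finite set. -/
theorem exists_pattern (h : Expressible G V S) (F : Finset Var) :
    ∃ P : Pattern D, P.Scoped V ∧ (∀ x ∈ P.vars, x ∈ F → x ∈ V) ∧
      ∀ i, P.eval (G i) = S i := by
  obtain ⟨P, ⟨h₁, h₂⟩, h₃⟩ := h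
  obtain ⟨ρ, hV, hF⟩ := exists_perm_avoiding V F (P.vars_finite.toFinset \ V)
    Finset.sdiff_disjoint
  have hmem (x : Var) : ρ x ∈ V ↔ x ∈ V := by
    refine ⟨fun h => ?_, fun h => (hV x h).symm ▸ h⟩
    have := hV _ h
    rw [ρ.injective this] at h
    exact h
  refine ⟨P.map ρ, ⟨h₁.map ρ, fun out hout => ?_⟩, ?_, fun i => ?_⟩
  · have := (h₂ (ρ ⁻¹' out) fun x hx hP => ?_).map ρ
    · rwa [Set.image_preimage_eq _ ρ.surjective] at this
    · exact (hmem x).1 (hout (ρ x) hx (by rw [Pattern.vars_map]; exact Set.mem_image_of_mem ρ hP))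
  · rw [Pattern.vars_map]
    rintro _ ⟨x, hx, rfl⟩ hxF
    by_contra hxV
    rw [hmem] at hxV
    exact hF x (by simp [hx, hxV]) hxF
  · have key (μ : Mapping D) (hμ : μ.dom ⊆ V) : (μ ∘ ρ : Mapping D) = μ := by
      ext1 x
      by_cases hx : x ∈ V
      · rw [Function.comp_apply, hV x hx]
      · have h₁ : μ x = none := by
          by_contra h
          exact hx (hμ h)
        have h₂ : μ (ρ x) = none := by
          by_contra h
          exact hx ((hmem x).1 (hμ h))
        rw [Function.comp_apply, h₁, h₂]
    ext μ
    rw [Pattern.mem_eval_map, (h₃ i).1]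
    refine ⟨fun h => ?_, fun h => ?_⟩
    · have hd : μ.dom ⊆ V := by
        intro x hx
        have : ρ.symm x ∈ (V : Set Var) := (h₃ i).2 _ h (by simpa [Mapping.dom] using hx)
        simpa using (hmem _).2 this
      rwa [key μ hd] at h
    · rwa [key μ ((h₃ i).2 μ h)]

/-- Two expressible families have patterns whose common variables are all visible in both. -/
theorem exists_patterns (hS : Expressible G V S) (hT : Expressible G W T) :
    ∃ P₁ P₂ : Pattern D, (∀ i, P₁.eval (G i) = S i) ∧ (∀ i, P₂.eval (G i) = T i) ∧
      P₁.WellFormed ∧ P₂.WellFormed ∧ ∀ out : Set Var,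
        (∀ x ∈ out, x ∈ P₁.vars ∪ P₂.vars → x ∈ V ∪ W) →
          P₁.NonParametricIn (out ∪ P₂.vars) ∧ P₂.NonParametricIn (out ∪ P₁.vars) := by
  obtain ⟨P₁, ⟨h₁, h₂⟩, h₃, h₄⟩ := hS.exists_pattern W
  obtain ⟨P₂, ⟨k₁, k₂⟩, k₃, k₄⟩ := hT.exists_pattern (V ∪ P₁.vars_finite.toFinset)
  simp only [Finset.mem_union, Set.Finite.mem_toFinset] at k₃
  refine ⟨P₁, P₂, h₄, k₄, h₁, k₁, fun out hout => ⟨h₂ _ ?_, k₂ _ ?_⟩⟩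
  · rintro x (hx | hx) hP
    · rcases Finset.mem_union.1 (hout x hx (.inl hP)) with h | h
      exacts [h, h₃ x hP h]
    · exact h₃ x hP (k₃ x hx (.inr hP))
  · rintro x (hx | hx) hP
    · rcases Finset.mem_union.1 (hout x hx (.inr hP)) with h | h
      exacts [k₃ x hP (.inl h), h]
    · exact k₃ x hP (.inr hx)

theorem congr (h : Expressible G V S) (hST : ∀ i, S i = T i) : Expressible G V T :=
  (funext hST : S = T) ▸ h

theorem and (hS : Expressible G V S) (hT : Expressible G W T) :
    Expressible G (V ∪ W) fun i =>
      {μ | ∃ μ₁ ∈ S i, ∃ μ₂ ∈ T i, μ₁.Compatible μ₂ ∧ μ = μ₁.union μ₂} := by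
  obtain ⟨P₁, P₂, h₁, h₂, w₁, w₂, h₃⟩ := hS.exists_patterns hT
  refine ⟨.and P₁ P₂, ⟨⟨w₁, w₂⟩, h₃⟩, fun i => ⟨by rw [Pattern.eval, h₁, h₂], ?_⟩⟩
  rintro _ ⟨μ₁, hμ₁, μ₂, hμ₂, -, rfl⟩
  rw [Mapping.dom_union, Finset.coe_union]
  exact Set.union_subset_union (hS.dom_subset hμ₁) (hT.dom_subset hμ₂)

theorem opt (hS : Expressible G V S) (hT : Expressible G W T) :
    Expressible G (V ∪ W) fun i =>
      {μ | ∃ μ₁ ∈ S i, ∃ μ₂ ∈ T i, μ₁.Compatible μ₂ ∧ μ = μ₁.union μ₂} ∪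
      {μ | μ ∈ S i ∧ ∀ μ' ∈ T i, ¬ μ.Compatible μ'} := by
  obtain ⟨P₁, P₂, h₁, h₂, w₁, w₂, h₃⟩ := hS.exists_patterns hT
  refine ⟨.opt P₁ P₂, ⟨⟨w₁, w₂⟩, h₃⟩, fun i => ⟨by rw [Pattern.eval, h₁, h₂], ?_⟩⟩
  rintro _ (⟨μ₁, hμ₁, μ₂, hμ₂, -, rfl⟩ | ⟨hμ, -⟩)
  · rw [Mapping.dom_union, Finset.coe_union]
    exact Set.union_subset_union (hS.dom_subset hμ₁) (hT.dom_subset hμ₂)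
  · exact (hS.dom_subset hμ).trans (by simp)

theorem union (hS : Expressible G V S) (hT : Expressible G V T) :
    Expressible G V fun i => S i ∪ T i := by
  obtain ⟨P₁, P₂, h₁, h₂, w₁, w₂, h₃⟩ := hS.exists_patterns hT
  rw [Finset.union_self] at h₃
  refine ⟨.union P₁ P₂, ⟨⟨w₁, w₂⟩, h₃⟩, fun i => ⟨by rw [Pattern.eval, h₁, h₂], ?_⟩⟩
  rintro μ (hμ | hμ)
  exacts [hS.dom_subset hμ, hT.dom_subset hμ]

theorem minus (hS : Expressible G V S) (hT : Expressible G V T) :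
    Expressible G V fun i =>
      {μ | μ ∈ S i ∧ ∀ μ' ∈ T i, ¬ μ.Compatible μ' ∨ μ.dom ∩ μ'.dom = ∅} := by
  obtain ⟨P₁, P₂, h₁, h₂, w₁, w₂, h₃⟩ := hS.exists_patterns hT
  rw [Finset.union_self] at h₃
  exact ⟨.minus P₁ P₂, ⟨⟨w₁, w₂⟩, h₃⟩, fun i => ⟨by rw [Pattern.eval, h₁, h₂],
    fun μ hμ => hS.dom_subset hμ.1⟩⟩

theorem filter (hS : Expressible G V S) (c : Cond D) (hc : c.vars ⊆ V) :
    Expressible G V fun i => {μ | μ ∈ S i ∧ c.Sat μ} := by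
  obtain ⟨P, ⟨h₁, h₂⟩, h₃⟩ := hS
  refine ⟨.filter P c, ⟨h₁, fun out hout => h₂ _ ?_⟩,
    fun i => ⟨by rw [Pattern.eval, (h₃ i).1], fun μ hμ => (h₃ i).2 μ hμ.1⟩⟩
  rintro x (hx | hx) hP
  exacts [hout x hx (.inl hP), hc hx]

theorem filter_forall (hS : Expressible G V S) (c : Var → Cond D) (W : Finset Var)
    (hc : ∀ x ∈ W, (c x).vars ⊆ V) :
    Expressible G V fun i => {μ | μ ∈ S i ∧ ∀ x ∈ W, (c x).Sat μ} := by
  induction W using Finset.induction_on with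
  | empty => simpa using hS
  | insert a W _ ih =>
    refine ((ih fun x hx => hc x (by simp [hx])).filter (c a) (hc a (by simp))).congr fun i => ?_
    ext μ
    simp only [Set.mem_ofPred_eq, Finset.forall_mem_insert]
    tauto

theorem restrict (hS : Expressible G V S) (hW : W ⊆ V) :
    Expressible G W fun i => {μ | ∃ μ' ∈ S i, μ = fun x => if x ∈ W then μ' x else none} := by
  obtain ⟨P, ⟨h₁, h₂⟩, h₃⟩ := hS
  refine ⟨.select [] W.toList P, ⟨⟨?_, by simp, h₁⟩, fun out hout => ⟨?_, h₂ _ ?_⟩⟩,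
    fun i => ⟨?_, ?_⟩⟩
  · simpa [Pattern.selectVars] using W.nodup_toList
  · intro x hx _ hk ho
    exact hk (by simpa using hout x ho (.inr hx))
  · rintro x (hx | hx) hP
    · exact hW (hout x hx (.inr hP))
    · exact hW (by simpa [Pattern.selectVars] using hx)
  · rw [Pattern.eval, (h₃ i).1]
    simp only [funext_iff]
    simp [Mapping.restrict, Mapping.rename]
  · rintro _ ⟨μ, -, rfl⟩ x hx
    by_contra h
    simp only [Finset.mem_coe] at h
    simp [Mapping.dom, h] at hx

theorem triple (s : PTerm D) (p : PPred) (o : PTerm D)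
    (hV : (Pattern.triple s p o).vars = V) :
    Expressible G V fun i => {μ | μ.dom = V ∧
      ∃ x ∈ (G i).1, s.subst μ = some (.node x.subj) ∧ p.subst μ = some (.node (.iri x.pred)) ∧
        o.subst μ = some x.obj} :=
  ⟨.triple s p o, ⟨trivial, fun _ _ => trivial⟩,
    fun i => ⟨by rw [Pattern.eval, hV], fun _ hμ => hμ.1.le⟩⟩

/-- The family with the empty mapping as the only answer. The empty pattern needs nonempty graphs
here. -/
theorem singleton_empty (hG : ∀ i, (G i).1.Nonempty) (V : Finset Var) :
    Expressible G V fun _ => {Mapping.empty} := by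
  refine ⟨.empty, ⟨trivial, fun _ _ => trivial⟩, fun i => ⟨?_, ?_⟩⟩
  · ext μ
    simp [Pattern.eval, hG i]
  · rintro _ rfl x hx
    exact absurd rfl hx

theorem empty (V : Finset Var) : Expressible G V fun _ => ∅ := by
  refine ⟨.filter .empty (.bound nullName), ⟨trivial, fun _ _ => trivial⟩, fun i => ⟨?_, by simp⟩⟩
  ext μ
  simp only [Pattern.eval, Set.mem_ofPred_eq, Set.mem_empty_iff_false, iff_false]
  rintro ⟨⟨rfl, -⟩, h⟩
  exact h rfl

theorem biUnion {κ : Type*} (L : Finset κ) {S : κ → ι → Set (Mapping D)}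
    (hS : ∀ k ∈ L, Expressible G V (S k)) : Expressible G V fun i => {μ | ∃ k ∈ L, μ ∈ S k i} := by
  classical
  induction L using Finset.induction_on with
  | empty => simpa using empty V
  | insert k L _ ih =>
    refine ((hS k (by simp)).union (ih fun j hj => hS j (by simp [hj]))).congr fun i => ?_
    ext μ
    simp

theorem filter_dom_eq (hS : Expressible G V S) (hW : W ⊆ V) :
    Expressible G V fun i => {μ | μ ∈ S i ∧ μ.dom = W} := by
  refine ((hS.filter_forall (fun x => if x ∈ W then .bound x else .not (.bound x)) V
    fun x hx => ?_).congr fun i => ?_)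
  · have : (if x ∈ W then Cond.bound x else .not (.bound x) : Cond D).vars = {x} := by
      split <;> rfl
    rw [this]
    simpa using hx
  · ext μ
    refine and_congr_right fun hμ => ?_
    have h : ∀ x, (if x ∈ W then Cond.bound x else .not (.bound x) : Cond D).Sat μ ↔
        (x ∈ μ.dom ↔ x ∈ W) := by
      intro x
      split <;> simp_all [Cond.Sat]
    simp only [h, Set.ext_iff, Finset.mem_coe]
    refine ⟨fun h x => ?_, fun h x _ => h x⟩
    by_cases hx : x ∈ V
    · exact h x hx
    · exact ⟨fun h => absurd (hS.dom_subset hμ h) hx, fun h => absurd (hW h) hx⟩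

/-- The answers with exactly the domain `W` that are not answers of a second family. `MINUS` keeps
a mapping whose domain is disjoint from those on its right-hand side, so both sides first get a
common variable, which ranges over the (existing) subjects of a fixed predicate and object. -/
theorem diff_of_dom_eq (hS : Expressible G V S) (hT : Expressible G V T) (hW : W ⊆ V) {p o : Str}
    (hG : ∀ i, ∃ s, (⟨s, p, .node (.iri o)⟩ : Triple D) ∈ (G i).1) :
    Expressible G V fun i => {μ | μ ∈ S i ∧ μ.dom = W ∧ μ ∉ T i} := by
  obtain ⟨x, hx⟩ := Infinite.exists_notMem_finset V
  have hM := triple (G := G) (V := {x}) (.var x) (.iri p) (.iri o)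
    (by simp [Pattern.vars, PTerm.vars, PPred.vars])
  refine ((((hS.filter_dom_eq hW).and hM).minus ((hT.filter_dom_eq hW).and hM)).restrict
    Finset.subset_union_left).congr fun i => ?_
  ext μ
  simp only [Set.mem_ofPred_eq]
  constructor
  · rintro ⟨_, ⟨⟨μ₁, ⟨hμ₁, hd⟩, m, hm, hc, rfl⟩, hmin⟩, rfl⟩
    have hne (y : Var) (hy : y ∈ V) : m y = none := by
      by_contra h
      have : y ∈ m.dom := h
      rw [hm.1] at this
      simp only [Finset.coe_singleton, Set.mem_singleton_iff] at this
      exact hx (this ▸ hy)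
    have heq : (fun y => if y ∈ V then (μ₁.union m) y else none) = μ₁ := by
      ext1 y
      by_cases hy : y ∈ V
      · simp [hy, Mapping.union, hne y hy]
      · rw [if_neg hy]
        by_contra h
        exact hy (hS.dom_subset hμ₁ (fun h' => h h'.symm))
    rw [heq]
    refine ⟨hμ₁, hd, fun hT₁ => ?_⟩
    rcases hmin _ ⟨μ₁, ⟨hT₁, hd⟩, m, hm, hc, rfl⟩ with h | h
    · exact h fun _ _ => rfl
    · rw [Set.inter_self, Mapping.dom_union, hm.1] at h
      have : x ∈ (∅ : Set Var) := h ▸ .inr (by simp)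
      exact this
  · rintro ⟨hμ, hd, hμT⟩
    obtain ⟨s, hs⟩ := hG i
    have hμx : μ x = none := by
      by_contra h
      exact hx (hS.dom_subset hμ h)
    refine ⟨μ.union fun y => if y = x then some (.node s) else none,
      ⟨⟨μ, ⟨hμ, hd⟩, _, ⟨?_, _, hs, ?_, rfl, rfl⟩, ?_, rfl⟩, ?_⟩, ?_⟩
    · ext y
      simp [Mapping.dom]
    · simp [PTerm.subst]
    · rintro y ⟨h₁, h₂⟩
      have : y = x := by
        by_contra h
        simp [Mapping.dom, h] at h₂
      exact absurd (this ▸ hμx) h₁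
    · rintro _ ⟨μ₂, ⟨hμ₂, hd₂⟩, m, hm, hc, rfl⟩
      refine .inl fun hcomp => hμT ?_
      have : μ = μ₂ := by
        ext1 y
        by_cases hy : y ∈ W
        · have h₁ : y ∈ μ.dom := hd ▸ hy
          have h₂ : y ∈ μ₂.dom := hd₂ ▸ hy
          have := hcomp y ⟨Mapping.dom_union ▸ .inl h₁, Mapping.dom_union ▸ .inl h₂⟩
          obtain ⟨a, ha⟩ := Option.ne_none_iff_exists'.1 h₁
          obtain ⟨b, hb⟩ := Option.ne_none_iff_exists'.1 h₂
          simpa [Mapping.union, ha, hb] using this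
        · have h₁ : y ∉ μ.dom := hd ▸ hy
          have h₂ : y ∉ μ₂.dom := hd₂ ▸ hy
          simp only [Mapping.dom, Set.mem_ofPred_eq, not_not] at h₁ h₂
          rw [h₁, h₂]
      exact this ▸ hμ₂
    · ext1 y
      by_cases hy : y ∈ V
      · have : y ≠ x := fun h => hx (h ▸ hy)
        simp [Mapping.union, hy, this]
      · rw [if_neg hy]
        by_contra h
        exact hy (hS.dom_subset hμ h)

theorem diff (hS : Expressible G V S) (hT : Expressible G V T) {p o : Str}
    (hG : ∀ i, ∃ s, (⟨s, p, .node (.iri o)⟩ : Triple D) ∈ (G i).1) :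
    Expressible G V fun i => S i \ T i := by
  refine (biUnion V.powerset fun W hW =>
    hS.diff_of_dom_eq hT (Finset.mem_powerset.1 hW) hG).congr fun i => ?_
  ext μ
  refine ⟨fun ⟨W, _, h⟩ => ⟨h.1, h.2.2⟩, fun ⟨h₁, h₂⟩ => ?_⟩
  have hf : μ.dom.Finite := V.finite_toSet.subset (hS.dom_subset h₁)
  exact ⟨hf.toFinset, by simpa using hS.dom_subset h₁, h₁, by simp, h₂⟩

end Expressible

/-! ### Generated identifiers -/

/-- A delimiter-free prefix can be read off a string in which a delimiter follows it. -/
theorem append_delimiter_inj {a b x y : Str} {c d : Char} (ha : ∀ e ∈ a, ¬ IsDelimiter e)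
    (hb : ∀ e ∈ b, ¬ IsDelimiter e) (hc : IsDelimiter c) (hd : IsDelimiter d)
    (h : a ++ c :: x = b ++ d :: y) : a = b ∧ c = d ∧ x = y := by
  induction a generalizing b with
  | nil =>
    cases b with
    | nil => simpa using h
    | cons e b =>
      rw [List.nil_append, List.cons_append, List.cons.injEq] at h
      exact absurd (h.1 ▸ hc) (hb e (by simp))
  | cons e a ih =>
    cases b with
    | nil =>
      rw [List.nil_append, List.cons_append, List.cons.injEq] at h
      exact absurd (h.1 ▸ hd) (ha e (by simp))
    | cons f b =>
      rw [List.cons_append, List.cons_append, List.cons.injEq] at h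
      obtain ⟨rfl, h⟩ := h
      obtain ⟨h₁, h₂⟩ := ih (fun e he => ha e (by simp [he])) (fun e he => hb e (by simp [he])) h
      exact ⟨by rw [h₁], h₂⟩

theorem isDelimiter_hash : IsDelimiter hash := .inl rfl

theorem isDelimiter_comma : IsDelimiter comma := .inr (.inl rfl)

theorem isDelimiter_equals : IsDelimiter equals := .inr (.inr rfl)

theorem hash_ne_comma : hash ≠ comma := by simp [hash, comma]

theorem comma_ne_equals : comma ≠ equals := by simp [equals, comma]

theorem Name.notMem_of_isDelimiter (A : Name) {c : Char} (hc : IsDelimiter c) : c ∉ A.1 :=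
  fun h => A.2 c h hc

namespace Encoding

variable (E : Encoding D)

theorem classIRI_inj {r s : Name} : E.classIRI r = E.classIRI s ↔ r = s := by
  simp [classIRI, Subtype.ext_iff]

theorem dtpIRI_inj {A B r s : Name} : E.dtpIRI A r = E.dtpIRI B s ↔ A = B ∧ r = s := by
  refine ⟨fun h => ?_, by rintro ⟨rfl, rfl⟩; rfl⟩
  simp only [dtpIRI, List.append_assoc, List.append_cancel_left_eq, List.singleton_append] at h
  obtain ⟨h₁, -, h₂⟩ := append_delimiter_inj r.2 s.2 isDelimiter_hash isDelimiter_hash h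
  exact ⟨Subtype.ext h₂, Subtype.ext h₁⟩

theorem binIRI_inj {r A B A' B' s X Y X' Y' : Name}
    (h : E.binIRI r A B A' B' = E.binIRI s X Y X' Y') :
    r = s ∧ A = X ∧ B = Y ∧ A' = X' ∧ B' = Y' := by
  simp only [binIRI, List.append_assoc, List.append_cancel_left_eq, List.singleton_append] at h
  have hc := isDelimiter_comma
  obtain ⟨h₁, -, h⟩ := append_delimiter_inj r.2 s.2 isDelimiter_hash isDelimiter_hash h
  obtain ⟨h₂, -, h⟩ := append_delimiter_inj A.2 X.2 hc hc h
  obtain ⟨h₃, -, h⟩ := append_delimiter_inj B.2 Y.2 hc hc h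
  obtain ⟨h₄, -, h₅⟩ := append_delimiter_inj A'.2 X'.2 hc hc h
  exact ⟨Subtype.ext h₁, Subtype.ext h₂, Subtype.ext h₃, Subtype.ext h₄, Subtype.ext h₅⟩

theorem dtpIRI_ne_binIRI (A r s X Y X' Y' : Name) : E.dtpIRI A r ≠ E.binIRI s X Y X' Y' := by
  intro h
  simp only [dtpIRI, binIRI, List.append_assoc, List.append_cancel_left_eq,
    List.singleton_append] at h
  obtain ⟨-, -, h⟩ := append_delimiter_inj r.2 s.2 isDelimiter_hash isDelimiter_hash h
  exact A.notMem_of_isDelimiter isDelimiter_comma (by simp [h])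

/-- The first delimiter in the identifier of a foreign key is a comma, in that of a data type
property it is a hash sign. -/
theorem dtpIRI_ne_fkIRI (A r s t : Name) (As Bs : List Name) :
    E.dtpIRI A r ≠ E.fkIRI As Bs s t := by
  intro h
  simp only [dtpIRI, fkIRI, List.append_assoc, List.append_cancel_left_eq,
    List.singleton_append] at h
  exact hash_ne_comma
    (append_delimiter_inj r.2 s.2 isDelimiter_hash isDelimiter_comma h).2.1

theorem binIRI_ne_fkIRI (r A B A' B' s t : Name) (As Bs : List Name) :
    E.binIRI r A B A' B' ≠ E.fkIRI As Bs s t := by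
  intro h
  simp only [binIRI, fkIRI, List.append_assoc, List.append_cancel_left_eq,
    List.singleton_append] at h
  exact hash_ne_comma
    (append_delimiter_inj r.2 s.2 isDelimiter_hash isDelimiter_comma h).2.1

theorem base_prefix_classIRI (r : Name) : E.base <+: E.classIRI r := List.prefix_append ..

theorem base_prefix_dtpIRI (A r : Name) : E.base <+: E.dtpIRI A r := by
  simp [dtpIRI, List.append_assoc]

theorem base_prefix_binIRI (r A B A' B' : Name) : E.base <+: E.binIRI r A B A' B' := by
  simp [binIRI, List.append_assoc]

theorem base_prefix_fkIRI (As Bs : List Name) (s t : Name) : E.base <+: E.fkIRI As Bs s t := by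
  simp [fkIRI, List.append_assoc]

variable {E}

theorem Admissible.ne_of_mem_vocabulary (hE : E.Admissible) {v w : Str} (hv : E.base <+: v)
    (hw : w ∈ vocabulary) : v ≠ w :=
  fun h => hE.base_not_prefix w hw (h ▸ hv)

theorem rowIRI_rel_inj {r s : Name} {As Bs : List Name} {vs ws : List (Option D)}
    (h : E.rowIRI r As vs = E.rowIRI s Bs ws) : r = s := by
  simp only [rowIRI, List.append_assoc, List.append_cancel_left_eq, List.singleton_append] at h
  exact Subtype.ext (append_delimiter_inj r.2 s.2 isDelimiter_hash isDelimiter_hash h).1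

/-- For non-null values, the node of a tuple determines the values in the key. -/
theorem Admissible.rowIRI_inj (hE : E.Admissible) {r s : Name} {As : List Name} (hA : As ≠ [])
    {f g : Name → Option D} (hf : ∀ A ∈ As, f A ≠ none) (hg : ∀ A ∈ As, g A ≠ none)
    (h : E.rowIRI r As (As.map f) = E.rowIRI s As (As.map g)) : ∀ A ∈ As, f A = g A := by
  simp only [rowIRI, List.append_assoc, List.append_cancel_left_eq, List.singleton_append,
    List.zipWith_map_right, List.zipWith_self] at h
  have h := (append_delimiter_inj r.2 s.2 isDelimiter_hash isDelimiter_hash h).2.2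
  have hcomma (k : Name → Option D) : ∀ l ∈ As.map fun A => A.1 ++ equals :: (E.lexNull (k A)).1,
      comma ∉ l := by
    intro l hl
    obtain ⟨A, -, rfl⟩ := List.mem_map.1 hl
    simp [Name.notMem_of_isDelimiter _ isDelimiter_comma, comma_ne_equals]
  have h := congrArg (List.splitOn comma) h
  rw [List.splitOn_intercalate _ (hcomma f) (by simpa using hA),
    List.splitOn_intercalate _ (hcomma g) (by simpa using hA), List.map_inj_left] at h
  intro A hAs
  have h := Subtype.ext (append_delimiter_inj A.2 A.2 isDelimiter_equals isDelimiter_equals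
    (h A hAs)).2.2
  obtain ⟨a, ha⟩ := Option.ne_none_iff_exists'.1 (hf A hAs)
  obtain ⟨b, hb⟩ := Option.ne_none_iff_exists'.1 (hg A hAs)
  rw [ha, hb] at h ⊢
  rw [hE.lex_injective h]

end Encoding

/-! ### Nodes of tuples, and the triples that store them -/

section

variable {E : Encoding D} {S : Schema} {C : Constraints S} {I : Instance D S}

theorem forall₂_value_iff {r : S.Rel} {t : Tuple D (S.att r)} (ht : t ∈ I.rel r) {As : List Name}
    (hA : ∀ A ∈ As, A ∈ S.att r) :
    List.Forall₂ (fun v A => I.Value v A t) (As.map t.val) As := by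
  rw [List.forall₂_map_left_iff, List.forall₂_same]
  exact fun A h => ⟨ht, hA A h, rfl⟩

theorem exists_tupleNode {r : S.Rel} {t : Tuple D (S.att r)} (hr : C.Class r) (ht : t ∈ I.rel r) :
    ∃ u, TupleNode E C I r t u := by
  by_cases hk : C.HasPK r
  · obtain ⟨As, k, hk, rfl, rfl⟩ := hk
    exact ⟨_, .row hr ⟨k, hk, rfl, rfl⟩ (forall₂_value_iff ht k.attrs_mem)⟩
  · obtain ⟨A, hA⟩ := S.att_nonempty r
    exact ⟨_, .blank hr hk ⟨ht, hA, rfl⟩⟩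

theorem TupleNode.class {r : S.Rel} {t : Tuple D (S.att r)} {u : Node}
    (h : TupleNode E C I r t u) : C.Class r := by
  cases h <;> assumption

theorem Constraints.PK.unique {r : S.Rel} {As Bs : List Name} (hA : C.PK As r) (hB : C.PK Bs r) :
    As = Bs := by
  obtain ⟨k, hk, rfl, rfl⟩ := hA
  obtain ⟨k', hk', h, rfl⟩ := hB
  rw [C.keys_unique k hk k' hk' h.symm]

/-- Different tuples of an instance that satisfies the constraints have different nodes. -/
theorem TupleNode.inj (hE : E.Admissible) (hI : I.Sat C) {r s : S.Rel} {t : Tuple D (S.att r)}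
    {t' : Tuple D (S.att s)} {u : Node} (h : TupleNode E C I r t u) (h' : TupleNode E C I s t' u) :
    (⟨r, t⟩ : (r : S.Rel) × Tuple D (S.att r)) = ⟨s, t'⟩ := by
  have ht := tupleNode_mem E C I h
  have ht' := tupleNode_mem E C I h'
  generalize hu : u = u' at h'
  cases h with
  | row _ hk hv =>
    cases h' with
    | row _ hk' hv' =>
      rw [Node.iri.injEq] at hu
      obtain rfl := Subtype.ext (Encoding.rowIRI_rel_inj hu)
      obtain rfl := hk.unique hk'
      rw [forall₂_value I hv, forall₂_value I hv'] at hu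
      obtain ⟨k, hk, rfl, rfl⟩ := hk
      have hs := hI.1 k hk
      rw [hs.2 _ ht _ ht' (hE.rowIRI_inj k.attrs_ne_nil (hs.1 _ ht) (hs.1 _ ht') hu)]
    | blank => cases hu
  | blank _ _ _ =>
    cases h' with
    | row => cases hu
    | blank _ _ _ =>
      rw [Node.blank.injEq] at hu
      exact hE.rowBlank_injective S I r s t t' ht ht' hu

theorem TupleNode.tuple_inj (hE : E.Admissible) (hI : I.Sat C) {r : S.Rel}
    {t t' : Tuple D (S.att r)} {u : Node} (h : TupleNode E C I r t u)
    (h' : TupleNode E C I r t' u) : t = t' :=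
  eq_of_heq (Sigma.mk.inj (h.inj hE hI h')).2

theorem Constraints.FKTo.class {r : S.Rel} (h : C.FKTo r) : C.Class r :=
  fun ⟨_, _, _, _, _, _, hb⟩ => hb.2.2.2.2.2.2.2.2.2 h

theorem Constraints.BinRel.class_left {r s t : S.Rel} {A B A' B' : Name}
    (h : C.BinRel r A B s A' t B') : C.Class s :=
  FKTo.class (.inl ⟨_, _, _, h.2.2.1⟩)

theorem Constraints.BinRel.class_right {r s t : S.Rel} {A B A' B' : Name}
    (h : C.BinRel r A B s A' t B') : C.Class t :=
  FKTo.class (.inl ⟨_, _, _, h.2.2.2.2.1⟩)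

/-- A relation that a binary relation refers to is not binary, so there is always a class. -/
theorem Constraints.exists_class (C : Constraints S) : ∃ r, C.Class r := by
  obtain ⟨r, hr⟩ := S.rels_nonempty
  by_cases h : C.IsBinRel ⟨r, hr⟩
  · obtain ⟨A, B, s, A', t, B', h⟩ := h
    exact ⟨s, h.class_left⟩
  · exact ⟨_, h⟩

theorem exists_isTriple_owlClass : ∃ s, IsTriple E C I ⟨s, rdfType, .node (.iri owlClass)⟩ := by
  obtain ⟨r, hr⟩ := C.exists_class
  exact ⟨_, .classDecl hr⟩

theorem isTriple_class_iff (hE : E.Admissible) {x : Triple D} {r : S.Rel}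
    (hp : x.pred = rdfType) (ho : x.obj = .node (.iri (E.classIRI r.1))) :
    IsTriple E C I x ↔ ∃ t, TupleNode E C I r t x.subj := by
  have hc {w : Str} (hw : w ∈ vocabulary) : (.node (.iri w) : Term D) ≠
      .node (.iri (E.classIRI r.1)) := fun h => by
    simp only [Term.node.injEq, Node.iri.injEq] at h
    exact hE.ne_of_mem_vocabulary (E.base_prefix_classIRI _) hw h.symm
  constructor
  · intro h
    cases h with
    | classDecl => exact absurd ho (hc (by simp [vocabulary]))
    | objPropDecl => exact absurd ho (hc (by simp [vocabulary]))
    | dtPropDecl => exact absurd ho (hc (by simp [vocabulary]))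
    | objPropDomain => simp [rdfType, rdfsDomain, ofCodes] at hp
    | objPropRange => simp [rdfType, rdfsRange, ofCodes] at hp
    | dtPropDomain => simp [rdfType, rdfsDomain, ofCodes] at hp
    | table _ h =>
      simp only [Term.node.injEq, Node.iri.injEq, E.classIRI_inj] at ho
      obtain rfl := Subtype.ext ho
      exact ⟨_, h⟩
    | binRef =>
      exact absurd hp
        (hE.ne_of_mem_vocabulary (E.base_prefix_binIRI ..) (by simp [vocabulary]))
    | fkRef =>
      exact absurd hp
        (hE.ne_of_mem_vocabulary (E.base_prefix_fkIRI ..) (by simp [vocabulary]))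
    | literal => cases ho
  · rintro ⟨t, h⟩
    obtain ⟨A, hA⟩ := S.att_nonempty r
    obtain ⟨s, p, o⟩ := x
    subst hp ho
    exact .table ⟨tupleNode_mem E C I h, hA, rfl⟩ h h.class

theorem isTriple_dtpIRI_iff (hE : E.Admissible) {x : Triple D} {r : S.Rel} {A : Name}
    (hr : C.Class r) (hA : A ∈ S.att r) (hp : x.pred = E.dtpIRI A r.1) :
    IsTriple E C I x ↔
      ∃ t d, TupleNode E C I r t x.subj ∧ t.val A = some d ∧ x.obj = .lit d := by
  have hc {w : Str} (hw : w ∈ vocabulary) : w ≠ E.dtpIRI A r.1 :=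
    (hE.ne_of_mem_vocabulary (E.base_prefix_dtpIRI _ _) hw).symm
  constructor
  · intro h
    cases h with
    | binRef => exact (E.dtpIRI_ne_binIRI _ _ _ _ _ _ _ hp.symm).elim
    | fkRef => exact (E.dtpIRI_ne_fkIRI _ _ _ _ _ _ hp.symm).elim
    | literal _ hv h =>
      obtain ⟨rfl, hr⟩ := E.dtpIRI_inj.1 hp
      obtain rfl := Subtype.ext hr
      exact ⟨_, _, h, hv.2.2, rfl⟩
    | _ => exact absurd hp (hc (by simp [vocabulary]))
  · rintro ⟨t, d, h, hv, ho⟩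
    obtain ⟨s, p, o⟩ := x
    subst hp ho
    exact .literal ⟨hA, hr⟩ ⟨tupleNode_mem E C I h, hA, hv⟩ h

/-- The referenced relations and attributes of a binary relation are determined by it. -/
theorem isTriple_binIRI_iff (hE : E.Admissible) {x : Triple D} {r s t : S.Rel} {A B A' B' : Name}
    (hb : C.BinRel r A B s A' t B') (hp : x.pred = E.binIRI r.1 A B A' B') :
    IsTriple E C I x ↔
      ∃ x₁ x₂ x₃ w, I.Value (x₂.val A') A x₁ ∧ I.Value (x₃.val B') B (r := r) x₁ ∧
        TupleNode E C I s x₂ x.subj ∧ TupleNode E C I t x₃ w ∧ x.obj = .node w := by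
  have hc {w : Str} (hw : w ∈ vocabulary) : w ≠ E.binIRI r.1 A B A' B' :=
    (hE.ne_of_mem_vocabulary (E.base_prefix_binIRI ..) hw).symm
  have hA' : A' ∈ S.att s := by
    obtain ⟨f, _, _, _, rfl, hf⟩ := hb.2.2.1
    exact f.dstAttrs_mem _ (by simp [hf])
  have hB' : B' ∈ S.att t := by
    obtain ⟨f, _, _, _, rfl, hf⟩ := hb.2.2.2.2.1
    exact f.dstAttrs_mem _ (by simp [hf])
  constructor
  · intro h
    cases h with
    | @binRef r₁ s₁ t₁ _ _ _ _ _ _ x₁ _ _ _ _ hb₁ h₁ h₂ h₃ h₄ h₅ h₆ =>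
      obtain ⟨hr, rfl, rfl, rfl, rfl⟩ := E.binIRI_inj hp
      obtain rfl := Subtype.ext hr
      have hs : s₁ = s := by
        by_contra h
        exact hb.2.2.2.2.2.2.1 ⟨_, _, _, _, hb₁.2.2.1, hb.2.2.1, .inr h⟩
      have ht : t₁ = t := by
        by_contra h
        exact hb.2.2.2.2.2.2.2.1 ⟨_, _, _, _, hb₁.2.2.2.2.1, hb.2.2.2.2.1, .inr h⟩
      subst hs ht
      refine ⟨x₁, _, _, _, ?_, ?_, h₅, h₆, rfl⟩
      · rwa [h₂.2.2]
      · rwa [h₄.2.2]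
    | fkRef => exact (E.binIRI_ne_fkIRI _ _ _ _ _ _ _ _ _ hp.symm).elim
    | literal => exact (E.dtpIRI_ne_binIRI _ _ _ _ _ _ _ hp).elim
    | _ => exact absurd hp (hc (by simp [vocabulary]))
  · rintro ⟨x₁, x₂, x₃, w, h₁, h₂, h₃, h₄, ho⟩
    obtain ⟨s, p, o⟩ := x
    subst hp ho
    exact .binRef hb h₁ ⟨tupleNode_mem E C I h₃, hA', rfl⟩ h₂
      ⟨tupleNode_mem E C I h₄, hB', rfl⟩ h₃ h₄

end

/-! ### Tuples and their mappings -/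

theorem Tuple.val_of_mem {U : Finset Name} (t : Tuple D U) {A : Name} (hA : A ∈ U) :
    t.val A = t ⟨A, hA⟩ := dif_pos hA

theorem Tuple.val_of_notMem {U : Finset Name} (t : Tuple D U) {A : Name} (hA : A ∉ U) :
    t.val A = none := dif_neg hA

theorem Tuple.exists_val_eq (U : Finset Name) (f : Name → Option D) :
    ∃ t : Tuple D U, ∀ A ∈ U, t.val A = f A :=
  ⟨fun A => f A.1, fun _ hA => Tuple.val_of_mem _ hA⟩

theorem tr_apply {U : Finset Name} (t : Tuple D U) (A : Name) :
    tr t A = (t.val A).map Term.lit := rfl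

theorem tr_of_notMem {U : Finset Name} (t : Tuple D U) {A : Name} (hA : A ∉ U) :
    tr t A = none := by
  rw [tr_apply, t.val_of_notMem hA, Option.map_none]

theorem lit_injective : Function.Injective (Term.lit : D → Term D) := fun _ _ => Term.lit.inj

theorem tr_apply_eq_iff {U V : Finset Name} {t : Tuple D U} {s : Tuple D V} {A B : Name} :
    tr t A = tr s B ↔ t.val A = s.val B :=
  (Option.map_injective lit_injective).eq_iff

theorem tr_apply_eq_none {U : Finset Name} {t : Tuple D U} {A : Name} :
    tr t A = none ↔ t.val A = none :=
  Option.map_eq_none_iff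

theorem tr_injective (U : Finset Name) : Function.Injective (tr : Tuple D U → Mapping D) := by
  intro t s h
  ext1 A
  rw [← t.val_of_mem A.2, ← s.val_of_mem A.2, ← tr_apply_eq_iff, h]

/-! ### The tuples of a relation -/

/-- The mapping with domain `{x, y}` and the values `a` and `b`, for `x ≠ y`. -/
def Mapping.pair (x : Var) (a : Term D) (y : Var) (b : Term D) : Mapping D := fun z =>
  if z = x then some a else if z = y then some b else none

theorem Expressible.triple_var_var {ι : Sort*} {G : ι → Graph D} {x y : Var} (hxy : x ≠ y)
    (p : Str) : Expressible G {x, y} fun i => {μ | ∃ T ∈ (G i).1, T.pred = p ∧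
      μ = Mapping.pair x (.node T.subj) y T.obj} := by
  refine (Expressible.triple (V := {x, y}) (.var x) (.iri p) (.var y) ?_).congr fun i => ?_
  · simp [Pattern.vars, PTerm.vars, PPred.vars, Set.pair_comm]
  · ext μ
    simp only [Set.mem_ofPred_eq, PTerm.subst, PPred.subst]
    constructor
    · rintro ⟨hd, T, hT, h₁, h₂, h₃⟩
      refine ⟨T, hT, by simpa using h₂.symm, ?_⟩
      ext1 z
      by_cases hx : z = x
      · simp [Mapping.pair, hx, h₁]
      · by_cases hy : z = y
        · simp [Mapping.pair, hy, hxy.symm, h₃]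
        · have : z ∉ μ.dom := by simp [hd, hx, hy]
          simpa [Mapping.pair, Mapping.dom, hx, hy] using this
    · rintro ⟨T, hT, rfl, rfl⟩
      refine ⟨?_, T, hT, by simp [Mapping.pair], rfl, by simp [Mapping.pair, hxy.symm]⟩
      ext z
      by_cases hx : z = x <;> simp [Mapping.dom, Mapping.pair, hx]

/-- The part of a tuple on the attributes in `L`, together with its node as the value of `x`. -/
def rowMapping {U : Finset Name} (x : Var) (u : Node) (t : Tuple D U) (L : Finset Name) :
    Mapping D := fun z =>
  if z = x then some (.node u) else if z ∈ L then tr t z else none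

section

variable {E : Encoding D} {S : Schema} (C : Constraints S)

/-- The graphs of the instances that satisfy the constraints. -/
def satGraph (E : Encoding D) (C : Constraints S) (I : {I : Instance D S // I.Sat C}) : Graph D :=
  DM E S C I.1

theorem mem_satGraph {I : {I : Instance D S // I.Sat C}} {x : Triple D} :
    x ∈ (satGraph E C I).1 ↔ IsTriple E C I.1 x := Iff.rfl

/-- The attributes of a class are collected by one `OPT` for each of them, since null values leave
no triple. The nodes are the values of a variable `x` here, so that all `OPT`s speak about the same
tuple. -/
theorem expressible_rowMapping (hE : E.Admissible) {r : S.Rel} (hr : C.Class r) {x : Var}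
    (hx : x ∉ S.att r) (L : Finset Name) (hL : L ⊆ S.att r) :
    Expressible (satGraph E C) (insert x L) fun I =>
      {μ | ∃ t u, TupleNode E C I.1 r t u ∧ μ = rowMapping x u t L} := by
  induction L using Finset.induction_on with
  | empty =>
    refine (Expressible.triple (V := {x}) (.var x) (.iri rdfType) (.iri (E.classIRI r.1))
      (by simp [Pattern.vars, PTerm.vars, PPred.vars])).congr fun I => ?_
    ext μ
    simp only [Set.mem_ofPred_eq, PTerm.subst, PPred.subst]
    constructor
    · rintro ⟨hd, T, hT, h₁, h₂, h₃⟩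
      obtain ⟨t, ht⟩ := (isTriple_class_iff hE (by simpa using h₂.symm)
        (by simpa using h₃.symm)).1 hT
      refine ⟨t, _, ht, ?_⟩
      ext1 z
      by_cases hz : z = x
      · simp [rowMapping, hz, h₁]
      · have : z ∉ μ.dom := by simp [hd, hz]
        simpa [rowMapping, Mapping.dom, hz] using this
    · rintro ⟨t, u, h, rfl⟩
      refine ⟨?_, ⟨u, rdfType, .node (.iri (E.classIRI r.1))⟩,
        (isTriple_class_iff hE rfl rfl).2 ⟨t, h⟩, by simp [rowMapping], rfl, rfl⟩
      ext z
      simp [Mapping.dom, rowMapping]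
  | insert A L hAL ih =>
    rw [Finset.insert_subset_iff] at hL
    have hxA : x ≠ A := fun h => hx (h ▸ hL.1)
    have hxL : x ∉ L := fun h => hx (hL.2 h)
    have h := (ih hL.2).opt (Expressible.triple_var_var (G := satGraph E C) hxA (E.dtpIRI A r.1))
    have hV : insert x L ∪ {x, A} = insert x (insert A L) := by
      ext z
      simp only [Finset.mem_union, Finset.mem_insert, Finset.mem_singleton]
      tauto
    rw [hV] at h
    refine h.congr fun I => ?_
    have hT (μ : Mapping D) : (∃ T ∈ (satGraph E C I).1, T.pred = E.dtpIRI A r.1 ∧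
        μ = Mapping.pair x (.node T.subj) A T.obj) ↔
        ∃ t u, TupleNode E C I.1 r t u ∧ t.val A ≠ none ∧ μ = rowMapping x u t {A} := by
      constructor
      · rintro ⟨T, hT, hp, rfl⟩
        obtain ⟨t, d, h₁, h₂, h₃⟩ := (isTriple_dtpIRI_iff hE hr hL.1 hp).1 hT
        refine ⟨t, _, h₁, by simp [h₂], ?_⟩
        ext1 z
        by_cases hz : z = A <;> simp [Mapping.pair, rowMapping, hz, tr_apply, h₂, h₃]
      · rintro ⟨t, u, h₁, h₂, rfl⟩
        obtain ⟨d, h₂⟩ := Option.ne_none_iff_exists'.1 h₂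
        refine ⟨⟨u, _, .lit d⟩, (isTriple_dtpIRI_iff hE hr hL.1 rfl).2 ⟨t, d, h₁, h₂, rfl⟩,
          rfl, ?_⟩
        ext1 z
        by_cases hz : z = A <;> simp [Mapping.pair, rowMapping, hz, tr_apply, h₂]
    have hcomp (u : Node) (t : Tuple D (S.att r)) :
        (rowMapping x u t L).Compatible (rowMapping x u t {A}) := by
      rintro z ⟨h₁, h₂⟩
      by_cases hz : z = x
      · simp [rowMapping, hz]
      · have hz' : z = A := by
          by_contra h
          simp [rowMapping, Mapping.dom, hz, h] at h₂
        simp [rowMapping, Mapping.dom, hz', hxA.symm, hAL] at h₁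
    have hunion (u : Node) (t : Tuple D (S.att r)) :
        (rowMapping x u t L).union (rowMapping x u t {A}) = rowMapping x u t (insert A L) := by
      ext1 z
      by_cases hz : z = x
      · simp [rowMapping, Mapping.union, hz]
      · by_cases hzA : z = A
        · simp [rowMapping, Mapping.union, hzA, hxA.symm, hAL]
        · simp [rowMapping, Mapping.union, hz, hzA]
    have hnull {u : Node} {t : Tuple D (S.att r)} (h : t.val A = none) :
        rowMapping x u t L = rowMapping x u t (insert A L) := by
      ext1 z
      by_cases hzA : z = A
      · simp [rowMapping, hzA, hAL, tr_apply, h]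
      · simp [rowMapping, hzA]
    ext μ
    simp only [Set.mem_union, Set.mem_ofPred_eq, hT]
    constructor
    · rintro (⟨_, ⟨t, u, h, rfl⟩, _, ⟨t', u', h', hA, rfl⟩, hc, rfl⟩ | ⟨⟨t, u, h, rfl⟩, hc⟩)
      · have := hc x ⟨by simp [Mapping.dom, rowMapping], by simp [Mapping.dom, rowMapping]⟩
        simp only [rowMapping, if_true, Option.some.injEq, Term.node.injEq] at this
        subst this
        obtain rfl := h.tuple_inj hE I.2 h'
        exact ⟨t, u, h, hunion u t⟩
      · refine ⟨t, u, h, hnull ?_⟩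
        by_contra hA
        exact hc _ ⟨t, u, h, hA, rfl⟩ (hcomp u t)
    · rintro ⟨t, u, h, rfl⟩
      by_cases hA : t.val A = none
      · refine .inr ⟨⟨t, u, h, (hnull hA).symm⟩, ?_⟩
        rintro _ ⟨t', u', h', hA', rfl⟩ hc
        have := hc x ⟨by simp [Mapping.dom, rowMapping], by simp [Mapping.dom, rowMapping]⟩
        simp only [rowMapping, if_true, Option.some.injEq, Term.node.injEq] at this
        subst this
        obtain rfl := h.tuple_inj hE I.2 h'
        exact hA' hA
      · exact .inl ⟨_, ⟨t, u, h, rfl⟩, _, ⟨t, u, h, hA, rfl⟩, hcomp u t, (hunion u t).symm⟩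

theorem expressible_class (hE : E.Admissible) {r : S.Rel} (hr : C.Class r) :
    Expressible (satGraph E C) (S.att r) fun I => tr '' I.1.rel r := by
  obtain ⟨x, hx⟩ := Infinite.exists_notMem_finset (S.att r)
  refine ((expressible_rowMapping C hE hr hx _ subset_rfl).restrict
    (Finset.subset_insert _ _)).congr fun I => ?_
  have h (t : Tuple D (S.att r)) (u : Node) :
      (fun z => if z ∈ S.att r then rowMapping x u t (S.att r) z else none) = tr t := by
    ext1 z
    by_cases hz : z ∈ S.att r
    · have : z ≠ x := fun h => hx (h ▸ hz)
      simp [rowMapping, hz, this]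
    · rw [if_neg hz, tr_of_notMem t hz]
  ext μ
  simp only [Set.mem_ofPred_eq, Set.mem_image]
  constructor
  · rintro ⟨_, ⟨t, u, ht, rfl⟩, rfl⟩
    exact ⟨t, tupleNode_mem E C I.1 ht, (h t u).symm⟩
  · rintro ⟨t, ht, rfl⟩
    obtain ⟨u, hu⟩ := exists_tupleNode (E := E) hr ht
    exact ⟨_, ⟨t, u, hu, rfl⟩, (h t u).symm⟩

/-- In an instance that satisfies a foreign key with one attribute, a non-null value of it is the
value of a tuple with a node. -/
theorem exists_tupleNode_of_FK {I : Instance D S} (hI : I.Sat C) {r s : S.Rel} {A A' : Name}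
    (hf : C.FK [A] r [A'] s) (hs : C.Class s) {t : Tuple D (S.att r)} (ht : t ∈ I.rel r)
    (hA : t.val A ≠ none) : ∃ t' u, TupleNode E C I s t' u ∧ t.val A = t'.val A' := by
  obtain ⟨f, hf, rfl, hA₁, rfl, hA₂⟩ := hf
  have h := (hI.2 f hf).2 t ht
  rw [hA₁, hA₂] at h
  rcases h with ⟨B, hB, h⟩ | ⟨t', ht', h⟩
  · obtain rfl := List.mem_singleton.1 hB
    exact absurd h hA
  · obtain ⟨u, hu⟩ := exists_tupleNode (E := E) hs ht'
    exact ⟨t', u, hu, by simpa using h⟩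

/-- A tuple of a binary relation is recovered from the link between the nodes `x` and `y` of the
tuples that it refers to, and from the values of these in the attributes that it refers to. -/
theorem expressible_binRel (hE : E.Admissible) {r s t : S.Rel} {A B A' B' : Name}
    (hb : C.BinRel r A B s A' t B') :
    Expressible (satGraph E C) (S.att r) fun I => tr '' I.1.rel r := by
  obtain ⟨k, hk, hkr, hkA⟩ := hb.1
  have hA : A ∈ S.att r := hkr ▸ k.attrs_mem A (by simp [hkA])
  have hB : B ∈ S.att r := hkr ▸ k.attrs_mem B (by simp [hkA])
  have hAB : A ≠ B := by
    have := k.attrs_nodup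
    rw [hkA] at this
    simpa using this
  have hatt : S.att r = {A, B} := by
    ext Z
    simp only [Finset.mem_insert, Finset.mem_singleton]
    refine ⟨fun hZ => ?_, by rintro (rfl | rfl) <;> assumption⟩
    by_contra! h
    exact hb.2.1 ⟨A, hA, B, hB, Z, hZ, hAB, h.1.symm, h.2.symm⟩
  have hA' : A' ∈ S.att s := by
    obtain ⟨f, _, _, _, rfl, hf⟩ := hb.2.2.1
    exact f.dstAttrs_mem _ (by simp [hf])
  have hB' : B' ∈ S.att t := by
    obtain ⟨f, _, _, _, rfl, hf⟩ := hb.2.2.2.2.1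
    exact f.dstAttrs_mem _ (by simp [hf])
  obtain ⟨x, hx⟩ := Infinite.exists_notMem_finset ({A, B} : Finset Var)
  obtain ⟨y, hy⟩ := Infinite.exists_notMem_finset ({A, B, x} : Finset Var)
  simp only [Finset.mem_insert, Finset.mem_singleton, not_or] at hx hy
  have hmem (z : Var) : z ∈ S.att r ↔ z = A ∨ z = B := by simp [hatt]
  refine ((((Expressible.triple_var_var (G := satGraph E C) (Ne.symm hy.2.2)
    (E.binIRI r.1 A B A' B')).and (Expressible.triple_var_var hx.1 (E.dtpIRI A' s.1))).and
    (Expressible.triple_var_var hy.2.1 (E.dtpIRI B' t.1))).restrict (W := S.att r)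
    (by simp [hatt, Finset.insert_subset_iff])).congr fun I => ?_
  have hrestrict (u w : Term D) (d d' : D) :
      (fun z => if z ∈ S.att r then (((Mapping.pair x u y w).union
        (Mapping.pair x u A (.lit d))).union (Mapping.pair y w B (.lit d'))) z else none) =
        Mapping.pair A (.lit d) B (.lit d') := by
    ext1 z
    by_cases h₁ : z = A
    · simp [h₁, hmem, Mapping.union, Mapping.pair, Ne.symm hx.1, Ne.symm hy.1]
    · by_cases h₂ : z = B
      · simp [h₂, hmem, Mapping.union, Mapping.pair, Ne.symm hx.2, Ne.symm hy.2.1, hAB.symm]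
      · simp [hmem, h₁, h₂, Mapping.pair]
  have htr {x₁ : Tuple D (S.att r)} {d d' : D} (h₁ : x₁.val A = some d)
      (h₂ : x₁.val B = some d') : tr x₁ = Mapping.pair A (.lit d) B (.lit d') := by
    ext1 z
    by_cases hz : z ∈ S.att r
    · rcases (hmem z).1 hz with rfl | rfl
      · simp [Mapping.pair, tr_apply, h₁]
      · simp [Mapping.pair, tr_apply, h₂, hAB.symm]
    · rw [tr_of_notMem _ hz]
      rw [hmem, not_or] at hz
      simp [Mapping.pair, hz]
  ext μ
  simp only [Set.mem_ofPred_eq, Set.mem_image, mem_satGraph]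
  constructor
  · rintro ⟨_, ⟨_, ⟨_, ⟨T₁, hT₁, hp₁, rfl⟩, _, ⟨T₂, hT₂, hp₂, rfl⟩, hc₁, rfl⟩,
      _, ⟨T₃, hT₃, hp₃, rfl⟩, hc₂, rfl⟩, rfl⟩
    obtain ⟨x₁, x₂, x₃, w, hv₁, hv₂, hu, hw, ho⟩ := (isTriple_binIRI_iff hE hb hp₁).1 hT₁
    obtain ⟨y₂, d, hu', hd, ho₂⟩ := (isTriple_dtpIRI_iff hE hb.class_left hA' hp₂).1 hT₂
    obtain ⟨y₃, d', hw', hd', ho₃⟩ := (isTriple_dtpIRI_iff hE hb.class_right hB' hp₃).1 hT₃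
    have hsu : T₁.subj = T₂.subj := by
      have := hc₁ x ⟨by simp [Mapping.dom, Mapping.pair], by simp [Mapping.dom, Mapping.pair]⟩
      simpa [Mapping.pair] using this
    have hsw : w = T₃.subj := by
      have := hc₂ y ⟨by simp [Mapping.dom, Mapping.union, Mapping.pair, hy.2.2],
        by simp [Mapping.dom, Mapping.pair]⟩
      simpa [Mapping.union, Mapping.pair, hy.2.2, ho] using this
    rw [← hsu] at hu'
    rw [← hsw] at hw'
    obtain rfl := hu.tuple_inj hE I.2 hu'
    obtain rfl := hw.tuple_inj hE I.2 hw'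
    refine ⟨x₁, hv₁.1, ?_⟩
    rw [← hsu, ← hsw, ho, ho₂, ho₃, hrestrict, htr (hv₁.2.2.trans hd) (hv₂.2.2.trans hd')]
  · rintro ⟨x₁, h₁, rfl⟩
    have hkey := (I.2.1 k hk).1
    rw [hkA] at hkey
    subst hkr
    have hnA := hkey x₁ h₁ A (by simp)
    have hnB := hkey x₁ h₁ B (by simp)
    obtain ⟨x₂, u, hu, hv₁⟩ := exists_tupleNode_of_FK (E := E) C I.2 hb.2.2.1 hb.class_left h₁ hnA
    obtain ⟨x₃, w, hw, hv₂⟩ :=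
      exists_tupleNode_of_FK (E := E) C I.2 hb.2.2.2.2.1 hb.class_right h₁ hnB
    obtain ⟨d, hd⟩ := Option.ne_none_iff_exists'.1 hnA
    obtain ⟨d', hd'⟩ := Option.ne_none_iff_exists'.1 hnB
    refine ⟨_, ⟨_, ⟨_, ⟨⟨u, _, .node w⟩, (isTriple_binIRI_iff hE hb rfl).2
        ⟨x₁, x₂, x₃, w, ⟨h₁, hA, hv₁⟩, ⟨h₁, hB, hv₂⟩, hu, hw, rfl⟩, rfl, rfl⟩,
      _, ⟨⟨u, _, .lit d⟩, (isTriple_dtpIRI_iff hE hb.class_left hA' rfl).2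
        ⟨x₂, d, hu, hv₁ ▸ hd, rfl⟩, rfl, rfl⟩, ?_, rfl⟩,
      _, ⟨⟨w, _, .lit d'⟩, (isTriple_dtpIRI_iff hE hb.class_right hB' rfl).2
        ⟨x₃, d', hw, hv₂ ▸ hd', rfl⟩, rfl, rfl⟩, ?_, rfl⟩, ?_⟩
    · rintro z ⟨h₁, h₂⟩
      by_cases hzx : z = x
      · simp [Mapping.pair, hzx]
      · have hzA : z = A := by
          by_contra h
          simp [Mapping.dom, Mapping.pair, hzx, h] at h₂
        simp [Mapping.dom, Mapping.pair, hzA, Ne.symm hx.1, Ne.symm hy.1] at h₁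
    · rintro z ⟨h₁, h₂⟩
      by_cases hzy : z = y
      · simp [Mapping.union, Mapping.pair, hzy, hy.2.2]
      · have hzB : z = B := by
          by_contra h
          simp [Mapping.dom, Mapping.pair, hzy, h] at h₂
        simp [Mapping.dom, Mapping.union, Mapping.pair, hzB, Ne.symm hx.2, Ne.symm hy.2.1,
          hAB.symm] at h₁
    · rw [hrestrict, htr hd hd']

/-! ### Relational algebra -/

theorem expressible_rel (hE : E.Admissible) (r : S.Rel) :
    Expressible (satGraph E C) (S.att r) fun I => tr '' I.1.rel r := by
  by_cases hr : C.IsBinRel r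
  · obtain ⟨A, B, s, A', t, B', hb⟩ := hr
    exact expressible_binRel C hE hb
  · exact expressible_class C hE hr

theorem Expressible.filter_tr {ι : Sort*} {G : ι → Graph D} {U : Finset Name}
    {X : ι → Set (Tuple D U)} (h : Expressible G U fun i => tr '' X i) (c : Cond D)
    (hc : c.vars ⊆ U) {p : Tuple D U → Prop} (hp : ∀ t, c.Sat (tr t) ↔ p t) :
    Expressible G U fun i => tr '' {t | t ∈ X i ∧ p t} := by
  refine (h.filter c hc).congr fun i => ?_
  ext μ
  constructor
  · rintro ⟨⟨t, ht, rfl⟩, hμ⟩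
    exact ⟨t, ⟨ht, (hp t).1 hμ⟩, rfl⟩
  · rintro ⟨t, ⟨ht, h⟩, rfl⟩
    exact ⟨⟨t, ht, rfl⟩, (hp t).2 h⟩

theorem eqLit_sat_tr {U : Finset Name} {t : Tuple D U} {A : Name} {a : D} :
    (Cond.eqLit A a).Sat (tr t) ↔ t.val A = some a := by
  rw [Cond.Sat, tr_apply, Option.map_eq_some_iff]
  simp

theorem bound_sat_tr {U : Finset Name} {t : Tuple D U} {A : Name} :
    (Cond.bound A).Sat (tr t) ↔ t.val A ≠ none :=
  not_congr tr_apply_eq_none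

/-- Renaming an attribute is the exchange of two variables, since the new one is not used. -/
theorem Expressible.rename_tr {ι : Sort*} {G : ι → Graph D} {U : Finset Name}
    {X : ι → Set (Tuple D U)} (h : Expressible G U fun i => tr '' X i) {A B : Name} (hA : A ∈ U)
    (hB : B ∉ U) : Expressible G (insert B (U.erase A)) fun i =>
      tr '' {t : Tuple D (insert B (U.erase A)) | ∃ t' ∈ X i, t.val B = t'.val A ∧
        ∀ C ∈ insert B (U.erase A), C ≠ B → t.val C = t'.val C} := by
  have hAB : A ≠ B := fun h => hB (h ▸ hA)
  have hV : U.image (Equiv.swap A B) = insert B (U.erase A) := by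
    ext y
    rw [← Equiv.coe_toEmbedding, ← Finset.map_eq_image, Finset.mem_map_equiv, Equiv.symm_swap,
      Finset.mem_insert, Finset.mem_erase]
    by_cases hyA : y = A
    · simp [hyA, hB, hAB]
    · by_cases hyB : y = B
      · simp [hyB, hA]
      · simp [Equiv.swap_apply_of_ne_of_ne hyA hyB, hyA, hyB]
  have key (t : Tuple D (insert B (U.erase A))) (t' : Tuple D U) :
      (tr t ∘ Equiv.swap A B : Mapping D) = tr t' ↔ t.val B = t'.val A ∧
        ∀ C ∈ insert B (U.erase A), C ≠ B → t.val C = t'.val C := by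
    constructor
    · intro h
      have h (z : Name) := congrFun h z
      simp only [Function.comp_apply, tr_apply_eq_iff] at h
      refine ⟨by simpa using h A, fun C hC hCB => ?_⟩
      have hCA : C ≠ A := fun h => by simp [h, hAB] at hC
      simpa [Equiv.swap_apply_of_ne_of_ne hCA hCB] using h C
    · rintro ⟨h₁, h₂⟩
      ext1 z
      rw [Function.comp_apply, tr_apply_eq_iff]
      by_cases hzA : z = A
      · simpa [hzA] using h₁
      · by_cases hzB : z = B
        · rw [hzB, Equiv.swap_apply_right, t'.val_of_notMem hB,
            t.val_of_notMem (by simp [hAB])]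
        · rw [Equiv.swap_apply_of_ne_of_ne hzA hzB]
          by_cases hz : z ∈ U
          · exact h₂ z (by simp [hz, hzA]) hzB
          · rw [t'.val_of_notMem hz, t.val_of_notMem (by simp [hz, hzB])]
  have h := h.perm (Equiv.swap A B)
  rw [hV] at h
  refine h.congr fun i => ?_
  ext μ
  constructor
  · rintro ⟨t', ht', hμ⟩
    obtain ⟨t, ht⟩ := Tuple.exists_val_eq (insert B (U.erase A))
      fun C => t'.val (Equiv.swap A B C)
    have h := (key t t').2 ⟨by simpa using ht B (by simp), fun C hC hCB => by
      have hCA : C ≠ A := fun h => by simp [h, hAB] at hC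
      rw [ht C hC, Equiv.swap_apply_of_ne_of_ne hCA hCB]⟩
    exact ⟨t, ⟨t', ht', (key t t').1 h⟩, Mapping.comp_injective (Equiv.swap A B) (h.trans hμ)⟩
  · rintro ⟨t, ⟨t', ht', h⟩, rfl⟩
    exact ⟨t', ht', ((key t t').2 h).symm⟩

theorem Expressible.proj_tr {ι : Sort*} {G : ι → Graph D} {U V : Finset Name}
    {X : ι → Set (Tuple D U)} (h : Expressible G U fun i => tr '' X i) (hV : V ⊆ U) :
    Expressible G V fun i =>
      tr '' {t : Tuple D V | ∃ t' ∈ X i, ∀ A ∈ V, t.val A = t'.val A} := by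
  have key {t : Tuple D V} {t' : Tuple D U} (h : ∀ A ∈ V, t.val A = t'.val A) :
      tr t = fun x => if x ∈ V then tr t' x else none := by
    ext1 x
    by_cases hx : x ∈ V
    · rw [if_pos hx, tr_apply_eq_iff, h x hx]
    · rw [if_neg hx, tr_of_notMem t hx]
  refine (h.restrict hV).congr fun i => ?_
  ext μ
  constructor
  · rintro ⟨_, ⟨t', ht', rfl⟩, rfl⟩
    obtain ⟨t, ht⟩ := Tuple.exists_val_eq V t'.val
    exact ⟨t, ⟨t', ht', ht⟩, key ht⟩
  · rintro ⟨t, ⟨t', ht', h⟩, rfl⟩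
    exact ⟨_, ⟨t', ht', rfl⟩, key h⟩

/-- Compatibility ignores unbound variables, whereas a null value excludes a tuple from a join.
Hence the common variables have to be bound on both sides. -/
theorem Expressible.join_tr {ι : Sort*} {G : ι → Graph D} {U V : Finset Name}
    {X : ι → Set (Tuple D U)} {Y : ι → Set (Tuple D V)}
    (hX : Expressible G U fun i => tr '' X i) (hY : Expressible G V fun i => tr '' Y i) :
    Expressible G (U ∪ V) fun i => tr '' {t : Tuple D (U ∪ V) | ∃ t₁ ∈ X i, ∃ t₂ ∈ Y i,
        (∀ A ∈ U ∩ V, t.val A = t₁.val A ∧ t₁.val A = t₂.val A ∧ t.val A ≠ none) ∧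
        (∀ A ∈ U \ V, t.val A = t₁.val A) ∧
        (∀ A ∈ V \ U, t.val A = t₂.val A)} := by
  have hU := hX.filter_forall Cond.bound (U ∩ V) fun x hx => by
    simpa [Cond.vars] using (Finset.mem_inter.1 hx).1
  have hV := hY.filter_forall Cond.bound (U ∩ V) fun x hx => by
    simpa [Cond.vars] using (Finset.mem_inter.1 hx).2
  have key {t : Tuple D (U ∪ V)} {t₁ : Tuple D U} {t₂ : Tuple D V}
      (h₁ : ∀ A ∈ U ∩ V, t.val A = t₁.val A ∧ t₁.val A = t₂.val A ∧ t.val A ≠ none)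
      (h₂ : ∀ A ∈ U \ V, t.val A = t₁.val A) (h₃ : ∀ A ∈ V \ U, t.val A = t₂.val A) :
      tr t = (tr t₁).union (tr t₂) := by
    ext1 z
    by_cases hzU : z ∈ U
    · by_cases hzV : z ∈ V
      · obtain ⟨h₁, h₂, h₃⟩ := h₁ z (Finset.mem_inter.2 ⟨hzU, hzV⟩)
        rw [Mapping.union, tr_apply, tr_apply, tr_apply, ← h₂, ← h₁, Option.or_self]
      · rw [Mapping.union, tr_of_notMem t₂ hzV, Option.or_none, tr_apply_eq_iff]
        exact h₂ z (Finset.mem_sdiff.2 ⟨hzU, hzV⟩)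
    · rw [Mapping.union, tr_of_notMem t₁ hzU, Option.none_or, tr_apply_eq_iff]
      by_cases hzV : z ∈ V
      · exact h₃ z (Finset.mem_sdiff.2 ⟨hzV, hzU⟩)
      · rw [t.val_of_notMem (by simp [hzU, hzV]), t₂.val_of_notMem hzV]
  refine (hU.and hV).congr fun i => ?_
  ext μ
  constructor
  · rintro ⟨_, ⟨⟨t₁, ht₁, rfl⟩, hb₁⟩, _, ⟨⟨t₂, ht₂, rfl⟩, hb₂⟩, hc, rfl⟩
    obtain ⟨t, ht⟩ := Tuple.exists_val_eq (U ∪ V) fun A => if A ∈ U then t₁.val A else t₂.val A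
    have h₁ : ∀ A ∈ U ∩ V, t.val A = t₁.val A ∧ t₁.val A = t₂.val A ∧ t.val A ≠ none := by
      intro A hA
      have h := ht A (Finset.mem_union_left _ (Finset.mem_inter.1 hA).1)
      rw [if_pos (Finset.mem_inter.1 hA).1] at h
      exact ⟨h, tr_apply_eq_iff.1 (hc A ⟨hb₁ A hA, hb₂ A hA⟩),
        h ▸ bound_sat_tr.1 (hb₁ A hA)⟩
    have h₂ : ∀ A ∈ U \ V, t.val A = t₁.val A := by
      intro A hA
      rw [ht A (by simp [(Finset.mem_sdiff.1 hA).1]), if_pos (Finset.mem_sdiff.1 hA).1]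
    have h₃ : ∀ A ∈ V \ U, t.val A = t₂.val A := by
      intro A hA
      rw [ht A (by simp [(Finset.mem_sdiff.1 hA).1]), if_neg (Finset.mem_sdiff.1 hA).2]
    exact ⟨t, ⟨t₁, ht₁, t₂, ht₂, h₁, h₂, h₃⟩, key h₁ h₂ h₃⟩
  · rintro ⟨t, ⟨t₁, ht₁, t₂, ht₂, h₁, h₂, h₃⟩, rfl⟩
    refine ⟨_, ⟨⟨t₁, ht₁, rfl⟩, fun A hA => ?_⟩, _, ⟨⟨t₂, ht₂, rfl⟩, fun A hA => ?_⟩, ?_,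
      key h₁ h₂ h₃⟩
    · obtain ⟨h₁, h₂, h₃⟩ := h₁ A hA
      exact bound_sat_tr.2 (h₁ ▸ h₃)
    · obtain ⟨h₁, h₂, h₃⟩ := h₁ A hA
      exact bound_sat_tr.2 (h₂ ▸ h₁ ▸ h₃)
    · rintro A ⟨hA₁, hA₂⟩
      have hU : A ∈ U := by
        by_contra h
        exact hA₁ (tr_of_notMem t₁ h)
      have hV : A ∈ V := by
        by_contra h
        exact hA₂ (tr_of_notMem t₂ h)
      exact tr_apply_eq_iff.2 (h₁ A (Finset.mem_inter.2 ⟨hU, hV⟩)).2.1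

/-- Every relational algebra query is expressible over the graphs of the direct mapping. -/
theorem RA.expressible (hE : E.Admissible) {U : Finset Name} (Q : RA D S U) :
    Expressible (satGraph E C) U fun I => tr '' Q.eval I.1 := by
  have hG (I : {I : Instance D S // I.Sat C}) :
      ∃ s, (⟨s, rdfType, .node (.iri owlClass)⟩ : Triple D) ∈ (satGraph E C I).1 :=
    exists_isTriple_owlClass
  induction Q with
  | rel r => exact expressible_rel C hE r
  | null A =>
    refine (Expressible.singleton_empty (fun I => ⟨_, (hG I).choose_spec⟩) {A}).congr fun I => ?_
    have key {t : Tuple D {A}} (ht : t.val A = none) : tr t = Mapping.empty := by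
      ext1 z
      by_cases hz : z = A
      · simp [hz, tr_apply, ht, Mapping.empty]
      · exact tr_of_notMem t (by simpa using hz)
    ext μ
    constructor
    · rintro rfl
      obtain ⟨t, ht⟩ := Tuple.exists_val_eq (D := D) {A} fun _ => none
      exact ⟨t, ht A (by simp), key (ht A (by simp))⟩
    · rintro ⟨t, ht, rfl⟩
      exact key ht
  | selEq A a hA Q ih =>
    exact ih.filter_tr (.eqLit A a) (by simpa [Cond.vars] using hA) fun _ => eqLit_sat_tr
  | selNe A a hA Q ih =>
    exact ih.filter_tr (.and (.bound A) (.not (.eqLit A a))) (by simpa [Cond.vars] using hA)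
      fun _ => and_congr bound_sat_tr (not_congr eqLit_sat_tr)
  | selNull A hA Q ih =>
    exact ih.filter_tr (.not (.bound A)) (by simpa [Cond.vars] using hA)
      fun _ => (not_congr bound_sat_tr).trans not_not
  | selNotNull A hA Q ih =>
    exact ih.filter_tr (.bound A) (by simpa [Cond.vars] using hA) fun _ => bound_sat_tr
  | proj V hV Q ih => exact ih.proj_tr hV
  | rename A B hA hB Q ih => exact ih.rename_tr hA hB
  | join Q₁ Q₂ ih₁ ih₂ => exact ih₁.join_tr ih₂
  | union Q₁ Q₂ ih₁ ih₂ =>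
    exact (ih₁.union ih₂).congr fun I => (Set.image_union ..).symm
  | diff Q₁ Q₂ ih₁ ih₂ =>
    exact (ih₁.diff ih₂ hG).congr fun I => (Set.image_sdiff (tr_injective _) _ _).symm

end

end DirectMap

theorem theorem2 {D : Type*} (E : DirectMap.Encoding D) (hE : E.Admissible) :
    DirectMap.QueryPreserving (DirectMap.DM E) := by
  intro S C U Q
  obtain ⟨P, ⟨h₁, h₂⟩, h₃⟩ := Q.expressible C hE
  exact ⟨⟨P, h₁, h₂ ∅ fun x hx => hx.elim⟩, fun I hI => (h₃ ⟨I, hI⟩).1.symm⟩
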